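/- **Theorem.** Let $S$ and $T$ be inverse semigroups (each element $s$ has a unique inverse $s^*$, i.e. a unique element with $s=ss^*s$ and $s^*=s^*ss^*$). Then $S$ and $T$ are strongly Morita equivalent if and only if they are semigroup Morita equivalent. Moreover, the following are equivalent: 1. $S$ and $T$ are *strongly Morita equivalent*: there is an equivalence biset, that is, an $(S,T)$-biset $X$ (a left $S$-set and right $T$-set with $(sx)t=s(xt)$) with surjective maps $\langle -,-\rangle\colon X\times X\to S$ and $[-,-]\colon X\times X\to T$ such that for all $x,y,z\in X$, $s\in S$, $t\in T$: $\langle sx,y\rangle=s\langle x,y\rangle$, $\langle y,x\rangle=\langle x,y\rangle^*$, $\langle x,x\rangle x=x$, $[x,yt]=[x,y]t$, $[x,y]=[y,x]^*$, $x[x,x]=x$, $\langle x,y\rangle z=x[y,z]$. 2. $S$ and $T$ are *topos Morita equivalent*: the classifying toposes $\mathscr B(S)$ and $\mathscr B(T)$ are equivalent categories. Here $\mathscr B(S)$ is the category of étale right $S$-sets: right $S$-sets $X$ with a map $p\colon X\to E(S)$ to the set of idempotents such that $p(xs)=s^*p(x)s$ and $x\,p(x)=x$; morphisms are the equivariant maps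 commuting with the projections to $E(S)$. 3. $S$ and $T$ are *semigroup Morita equivalent*: the categories of closed right $S$-sets and of closed right $T$-sets are equivalent, where a right $S$-set $X$ is closed if $X\otimes_S S\to X$, $x\otimes s\mapsto xs$, is bijective, and morphisms are equivariant maps. 4. The categories of unitary right $S$-sets ($XS=X$) and of unitary right $T$-sets, with equivariant maps, are equivalent. 5. $S$ and $T$ are *enlargement Morita equivalent*: there is an ordered groupoid $G$ that is an enlargement of both inductive groupoids $G(S)$ and $G(T)$. Here an ordered groupoid is a groupoid internal to posets whose domain map is a discrete fibration; $G(S)$ has arrows $s\colon s^*s\to ss^*$ for $s\in S$, objects the idempotents, the restricted product and the natural partial order; and $G$ is an enlargement of $H$ if $H$ is (isomorphic to) a full subgroupoid of $G$ with the induced order which is an order ideal, and every object of $G$ is isomorphic to an object of $H$. Furthermore $\mathscr B(S)$ is equivalent to the category $\mathrm{PSh}(L(S))$ of presheaves of sets on $L(S)$, and likewise for $T$, where $L(S)$ has the idempotents of $S$ as objects, the elements $s\in S$ with $es=s$ and $s^*s=d$ as arrows $d\to e$, and the product of $S$ as composition. In particular, topos Morita equivalence implies strong Morita equivalence. -/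

import Mathlib

universe u

namespace InverseSemigroup

open CategoryTheory MulOpposite

/-! ### Inverse semigroups -/

/-- A semigroup is inverse if each element `s` has a unique inverse, that is, a unique `t` with
`s = sts` and `t = tst`. -/
class IsInverseSemigroup (S : Type u) [Semigroup S] : Prop where
  existsUnique_inverse : ∀ s : S, ∃! t : S, s = s * t * s ∧ t = t * s * t

section Basic

variable {S : Type u} [Semigroup S] [IsInverseSemigroup S]

/-- The unique inverse `s*` of an element `s` of an inverse semigroup. -/
noncomputable def star (s : S) : S :=
  (IsInverseSemigroup.existsUnique_inverse s).choose

theorem mul_star_mul (s : S) : s * star s * s = s :=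
  (IsInverseSemigroup.existsUnique_inverse s).choose_spec.1.1.symm

theorem star_mul_star (s : S) : star s * s * star s = star s :=
  (IsInverseSemigroup.existsUnique_inverse s).choose_spec.1.2.symm

theorem star_eq {s t : S} (h₁ : s * t * s = s) (h₂ : t * s * t = t) : star s = t :=
  ((IsInverseSemigroup.existsUnique_inverse s).choose_spec.2 t ⟨h₁.symm, h₂.symm⟩).symm

theorem star_star (s : S) : star (star s) = s :=
  star_eq (star_mul_star s) (mul_star_mul s)

theorem star_idem {e : S} (he : e * e = e) : star e = e :=
  star_eq (by rw [he, he]) (by rw [he, he])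

theorem star_mul_self_idem (s : S) : (star s * s) * (star s * s) = star s * s := by
  rw [← mul_assoc, star_mul_star]

theorem mul_star_self_idem (s : S) : (s * star s) * (s * star s) = s * star s := by
  rw [← mul_assoc, mul_star_mul]

theorem idem_mul_idem {e f : S} (he : e * e = e) (hf : f * f = f) :
    (e * f) * (e * f) = e * f := by
  have hx : star (e * f) = f * star (e * f) * e := by
    refine star_eq ?_ ?_
    · calc e * f * (f * star (e * f) * e) * (e * f)
          = e * (f * f) * star (e * f) * (e * e) * f := by simp only [mul_assoc]
        _ = e * f * star (e * f) * (e * f) := by rw [he, hf]; simp only [mul_assoc]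
        _ = e * f := mul_star_mul _
    · calc f * star (e * f) * e * (e * f) * (f * star (e * f) * e)
          = f * (star (e * f) * ((e * e) * (f * f)) * star (e * f)) * e := by
            simp only [mul_assoc]
        _ = f * star (e * f) * e := by rw [he, hf, star_mul_star]
  have hi : star (e * f) * star (e * f) = star (e * f) := by
    calc star (e * f) * star (e * f)
        = (f * star (e * f) * e) * (f * star (e * f) * e) := by rw [← hx]
      _ = f * (star (e * f) * (e * f) * star (e * f)) * e := by simp only [mul_assoc]
      _ = star (e * f) := by rw [star_mul_star, ← hx]
  have h := star_idem hi
  rw [star_star] at h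
  rw [h, hi]

theorem idem_comm {e f : S} (he : e * e = e) (hf : f * f = f) : e * f = f * e := by
  have h₁ := idem_mul_idem he hf
  have h₂ := idem_mul_idem hf he
  have h := star_idem h₁
  rw [← h]
  refine star_eq ?_ ?_
  · calc e * f * (f * e) * (e * f) = e * (f * f) * (e * e) * f := by simp only [mul_assoc]
      _ = e * f * (e * f) := by rw [he, hf]; simp only [mul_assoc]
      _ = e * f := h₁
  · calc f * e * (e * f) * (f * e) = f * (e * e) * (f * f) * e := by simp only [mul_assoc]
      _ = f * e * (f * e) := by rw [he, hf]; simp only [mul_assoc]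
      _ = f * e := h₂

theorem star_mul (s t : S) : star (s * t) = star t * star s := by
  have hc : (t * star t) * (star s * s) = (star s * s) * (t * star t) :=
    idem_comm (mul_star_self_idem t) (star_mul_self_idem s)
  refine star_eq ?_ ?_
  · calc s * t * (star t * star s) * (s * t)
        = s * ((t * star t) * (star s * s)) * t := by simp only [mul_assoc]
      _ = (s * star s * s) * (t * star t * t) := by rw [hc]; simp only [mul_assoc]
      _ = s * t := by rw [mul_star_mul, mul_star_mul]
  · calc star t * star s * (s * t) * (star t * star s)
        = star t * ((star s * s) * (t * star t)) * star s := by simp only [mul_assoc]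
      _ = (star t * t * star t) * (star s * s * star s) := by rw [← hc]; simp only [mul_assoc]
      _ = star t * star s := by rw [star_mul_star, star_mul_star]

/-- `s* e s` is idempotent whenever `e` is. -/
theorem conj_idem {e : S} (he : e * e = e) (s : S) :
    (star s * e * s) * (star s * e * s) = star s * e * s := by
  calc (star s * e * s) * (star s * e * s)
      = star s * (e * (s * star s)) * e * s := by simp only [mul_assoc]
    _ = (star s * s * star s) * (e * e) * s := by
      rw [idem_comm he (mul_star_self_idem s)]; simp only [mul_assoc]
    _ = star s * e * s := by rw [star_mul_star, he]

theorem mul_conj {e : S} (he : e * e = e) (s : S) : s * (star s * e * s) = e * s := by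
  calc s * (star s * e * s) = ((s * star s) * e) * s := by simp only [mul_assoc]
    _ = e * (s * star s * s) := by
      rw [idem_comm (mul_star_self_idem s) he]; simp only [mul_assoc]
    _ = e * s := by rw [mul_star_mul]

end Basic

/-! ### Idempotents and the natural partial order -/

/-- The set `E(S)` of idempotents. -/
@[ext]
structure Idem (S : Type u) [Semigroup S] where
  val : S
  mul_self : val * val = val

/-- The order on `E(S)`: `e ≤ f` if and only if `e = ef = fe`. -/
instance Idem.instPartialOrder (S : Type u) [Semigroup S] : PartialOrder (Idem S) where
  le e f := e.1 = e.1 * f.1 ∧ e.1 = f.1 * e.1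
  le_refl e := ⟨e.2.symm, e.2.symm⟩
  le_trans a b c hab hbc := by
    refine ⟨?_, ?_⟩
    · calc a.1 = a.1 * (b.1 * c.1) := by rw [← hbc.1, ← hab.1]
        _ = a.1 * c.1 := by rw [← mul_assoc, ← hab.1]
    · calc a.1 = (c.1 * b.1) * a.1 := by rw [← hbc.2, ← hab.2]
        _ = c.1 * a.1 := by rw [mul_assoc, ← hab.2]
  le_antisymm a b hab hba := Idem.ext (hab.1.trans hba.2.symm)

section Idempotents

variable {S : Type u} [Semigroup S] [IsInverseSemigroup S]

/-- The idempotent `s*s`. -/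
noncomputable def domIdem (s : S) : Idem S := ⟨star s * s, star_mul_self_idem s⟩

/-- The idempotent `ss*`. -/
noncomputable def codIdem (s : S) : Idem S := ⟨s * star s, mul_star_self_idem s⟩

/-- The Munn action of `S` on `E(S)`: `e · s = s*es`. -/
noncomputable def munn (e : Idem S) (s : S) : Idem S := ⟨star s * e.1 * s, conj_idem e.2 s⟩

variable (S) in
/-- The natural partial order of an inverse semigroup: `s ≤ t` if and only if `s = et` for some
idempotent `e`. -/
@[reducible]
def naturalOrder : PartialOrder S where
  le s t := ∃ e : S, e * e = e ∧ s = e * t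
  le_refl s := ⟨s * star s, mul_star_self_idem s, (mul_star_mul s).symm⟩
  le_trans := by
    rintro a b c ⟨e, he, rfl⟩ ⟨f, hf, rfl⟩
    exact ⟨e * f, idem_mul_idem he hf, (mul_assoc _ _ _).symm⟩
  le_antisymm := by
    rintro a b ⟨e, he, hab⟩ ⟨f, hf, hba⟩
    have h1 : e * a = a := by rw [hab, ← mul_assoc, he]
    have h2 : f * b = b := by rw [hba, ← mul_assoc, hf]
    calc a = e * b := hab
      _ = e * (f * a) := by rw [← hba]
      _ = f * (e * a) := by rw [← mul_assoc, idem_comm he hf, mul_assoc]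
      _ = b := by rw [h1, ← hba]

end Idempotents

/-! ### Strong Morita equivalence -/

section Strong

open scoped RightActions

/-- The structure of an equivalence biset on an `(S, T)`-biset `X`
(here `x <• t` is the right action). -/
structure EquivalenceBiset (S T X : Type u) [Semigroup S] [IsInverseSemigroup S]
    [Semigroup T] [IsInverseSemigroup T] [SemigroupAction S X] [SemigroupAction Tᵐᵒᵖ X]
    [SMulCommClass S Tᵐᵒᵖ X] where
  /-- the form `⟨x, y⟩` -/
  l : X → X → S
  /-- the form `[x, y]` -/
  r : X → X → T
  l_surjective : ∀ s : S, ∃ x y : X, l x y = s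
  r_surjective : ∀ t : T, ∃ x y : X, r x y = t
  l_smul : ∀ (s : S) (x y : X), l (s • x) y = s * l x y
  l_star : ∀ x y : X, l y x = star (l x y)
  l_self_smul : ∀ x : X, l x x • x = x
  r_smul : ∀ (x y : X) (t : T), r x (y <• t) = r x y * t
  r_star : ∀ x y : X, r x y = star (r y x)
  smul_r_self : ∀ x : X, x <• r x x = x
  l_smul_eq : ∀ x y z : X, l x y • z = x <• r y z

/-- Strong Morita equivalence: there is an equivalence biset. -/
def StronglyMoritaEquivalent (S T : Type u) [Semigroup S] [IsInverseSemigroup S]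
    [Semigroup T] [IsInverseSemigroup T] : Prop :=
  ∃ (X : Type u) (_ : SemigroupAction S X) (_ : SemigroupAction Tᵐᵒᵖ X)
    (_ : SMulCommClass S Tᵐᵒᵖ X), Nonempty (EquivalenceBiset S T X)

end Strong

/-! ### Right `S`-sets; semigroup Morita equivalence -/

section Sets

open scoped RightActions

/-- A right `S`-set. -/
structure RightSet (S : Type u) [Semigroup S] where
  carrier : Type u
  [action : SemigroupAction Sᵐᵒᵖ carrier]

attribute [instance] RightSet.action

variable {S : Type u} [Semigroup S]

/-- A morphism of right `S`-sets is an equivariant map. -/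
@[ext]
structure RightSet.Hom (X Y : RightSet S) where
  hom : X.carrier →[Sᵐᵒᵖ] Y.carrier

instance RightSet.instCategory : Category.{u} (RightSet S) where
  Hom X Y := RightSet.Hom X Y
  id X := ⟨MulActionHom.id Sᵐᵒᵖ⟩
  comp f g := ⟨g.hom.comp f.hom⟩

namespace RightSet

/-- `X` is unitary: `XS = X`. -/
def IsUnitary (X : RightSet S) : Prop :=
  ∀ x : X.carrier, ∃ (s : S) (y : X.carrier), y <• s = x

/-- The generating relation `(xs, t) ~ (x, st)` of the tensor product `X ⊗_S S`. -/
def TensorRel (X : RightSet S) (a b : X.carrier × S) : Prop :=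
  ∃ (x : X.carrier) (s t : S), a = (x <• s, t) ∧ b = (x, s * t)

/-- The tensor product `X ⊗_S S`: the quotient of `X × S` by the equivalence relation generated by
`(xs, t) ~ (x, st)`. -/
def Tensor (X : RightSet S) : Type u := Quot X.TensorRel

/-- The map `X ⊗_S S → X`, `x ⊗ s ↦ xs`. -/
def tensorMap (X : RightSet S) : X.Tensor → X.carrier :=
  Quot.lift (fun a => a.1 <• a.2) (by
    rintro _ _ ⟨x, s, t, rfl, rfl⟩
    exact (mul_smul (op t) (op s) x).symm)

/-- `X` is closed: the map `X ⊗_S S → X` is bijective. -/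
def IsClosed (X : RightSet S) : Prop := Function.Bijective X.tensorMap

end RightSet

/-- The category of closed right `S`-sets, with equivariant maps. -/
abbrev ClosedSet (S : Type u) [Semigroup S] :=
  ObjectProperty.FullSubcategory (fun X : RightSet S => X.IsClosed)

/-- The category of unitary right `S`-sets, with equivariant maps. -/
abbrev UnitarySet (S : Type u) [Semigroup S] :=
  ObjectProperty.FullSubcategory (fun X : RightSet S => X.IsUnitary)

/-- Semigroup Morita equivalence: the categories of closed right sets are equivalent. -/
def SemigroupMoritaEquivalent (S T : Type u) [Semigroup S] [Semigroup T] : Prop :=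
  Nonempty (ClosedSet S ≌ ClosedSet T)

end Sets

/-! ### Étale sets; topos Morita equivalence -/

section Topos

open scoped RightActions

/-- An étale right `S`-set: a right `S`-set `X` with an equivariant map `p` to the Munn `S`-set
`E(S)` such that `x p(x) = x`. -/
structure EtaleSet (S : Type u) [Semigroup S] [IsInverseSemigroup S] where
  carrier : Type u
  [action : SemigroupAction Sᵐᵒᵖ carrier]
  p : carrier → Idem S
  p_smul : ∀ (x : carrier) (s : S), p (x <• s) = munn (p x) s
  smul_p : ∀ x : carrier, x <• (p x).1 = x

attribute [instance] EtaleSet.action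

variable (S : Type u) [Semigroup S] [IsInverseSemigroup S]

variable {S} in
/-- A morphism of étale right `S`-sets is an equivariant map that commutes with the projections
to `E(S)`. -/
@[ext]
structure EtaleSet.Hom (X Y : EtaleSet S) where
  hom : X.carrier →[Sᵐᵒᵖ] Y.carrier
  p_hom : ∀ x, Y.p (hom x) = X.p x

/-- The classifying topos `B(S)`: the category of étale right `S`-sets. -/
instance EtaleSet.instCategory : Category.{u} (EtaleSet S) where
  Hom X Y := EtaleSet.Hom X Y
  id X := ⟨MulActionHom.id Sᵐᵒᵖ, fun _ => rfl⟩
  comp f g := ⟨g.hom.comp f.hom, fun x => (g.p_hom (f.hom x)).trans (f.p_hom x)⟩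

/-- Topos Morita equivalence: the classifying toposes are equivalent. -/
def ToposMoritaEquivalent (S T : Type u) [Semigroup S] [IsInverseSemigroup S]
    [Semigroup T] [IsInverseSemigroup T] : Prop :=
  Nonempty (EtaleSet S ≌ EtaleSet T)

/-- The objects of the category `L(S)` are the idempotents of `S`. -/
structure LCat where
  idem : Idem S

variable {S} in
/-- An arrow `d ⟶ e` of `L(S)` is an element `s` of `S` with `es = s` and `s*s = d`. -/
@[ext]
structure LCat.Hom (d e : LCat S) where
  val : S
  idem_mul : e.idem.val * val = val
  star_mul_self : star val * val = d.idem.val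

/-- The category `L(S)`: the composite of `t : c ⟶ d` followed by `s : d ⟶ e` is `st`. -/
noncomputable instance LCat.instCategory : Category.{u} (LCat S) where
  Hom d e := LCat.Hom d e
  id e := ⟨e.idem.val, e.idem.mul_self, by rw [star_idem e.idem.mul_self, e.idem.mul_self]⟩
  comp {c d e} t s := ⟨s.val * t.val, by rw [← mul_assoc, s.idem_mul], by
    rw [star_mul]
    calc star t.val * star s.val * (s.val * t.val)
        = star t.val * ((star s.val * s.val) * t.val) := by simp only [mul_assoc]
      _ = c.idem.val := by rw [s.star_mul_self, t.idem_mul, t.star_mul_self]⟩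
  id_comp {d e} s := LCat.Hom.ext (by
    change s.val * d.idem.val = s.val
    rw [← s.star_mul_self, ← mul_assoc, mul_star_mul])
  comp_id s := LCat.Hom.ext s.idem_mul
  assoc r s t := LCat.Hom.ext (mul_assoc t.val s.val r.val).symm

end Topos

/-! ### Ordered groupoids; enlargement Morita equivalence -/

/-- An ordered groupoid: a groupoid internal to posets whose domain map is a discrete fibration.
The product `mul g h` ("first `h`, then `g`") is defined when `dom g = cod h`. -/
structure OrderedGroupoid where
  Obj : Type u
  Arr : Type u
  [objOrder : PartialOrder Obj]
  [arrOrder : PartialOrder Arr]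
  dom : Arr → Obj
  cod : Arr → Obj
  one : Obj → Arr
  inv : Arr → Arr
  mul : ∀ g h : Arr, dom g = cod h → Arr
  dom_one : ∀ x, dom (one x) = x
  cod_one : ∀ x, cod (one x) = x
  dom_mul : ∀ g h p, dom (mul g h p) = dom h
  cod_mul : ∀ g h p, cod (mul g h p) = cod g
  dom_inv : ∀ g, dom (inv g) = cod g
  cod_inv : ∀ g, cod (inv g) = dom g
  mul_assoc : ∀ g h k (p : dom g = cod h) (q : dom h = cod k),
    mul (mul g h p) k ((dom_mul g h p).trans q) = mul g (mul h k q) (p.trans (cod_mul h k q).symm)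
  mul_one : ∀ g, mul g (one (dom g)) (cod_one (dom g)).symm = g
  one_mul : ∀ g, mul (one (cod g)) g (dom_one (cod g)) = g
  mul_inv : ∀ g, mul g (inv g) (cod_inv g).symm = one (cod g)
  inv_mul : ∀ g, mul (inv g) g (dom_inv g) = one (dom g)
  dom_mono : Monotone dom
  cod_mono : Monotone cod
  one_mono : Monotone one
  inv_mono : Monotone inv
  mul_mono : ∀ g h g' h' (p : dom g = cod h) (p' : dom g' = cod h'),
    g ≤ g' → h ≤ h' → mul g h p ≤ mul g' h' p'
  dom_fibration : ∀ (g : Arr) (x : Obj), x ≤ dom g → ∃! h : Arr, h ≤ g ∧ dom h = x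

attribute [instance] OrderedGroupoid.objOrder OrderedGroupoid.arrOrder

/-- `Enlargement H G` exhibits `G` as an enlargement of (an isomorphic copy of) `H`: an isomorphism
of `H` with a full subgroupoid of `G`, with the induced order, which is an order ideal and meets
every isomorphism class of objects of `G`. -/
structure Enlargement (H G : OrderedGroupoid.{u}) where
  obj : H.Obj → G.Obj
  arr : H.Arr → G.Arr
  dom_arr : ∀ g, G.dom (arr g) = obj (H.dom g)
  cod_arr : ∀ g, G.cod (arr g) = obj (H.cod g)
  arr_one : ∀ x, arr (H.one x) = G.one (obj x)
  arr_mul : ∀ g h (p : H.dom g = H.cod h) (q : G.dom (arr g) = G.cod (arr h)),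
    arr (H.mul g h p) = G.mul (arr g) (arr h) q
  obj_le_iff : ∀ x y, obj x ≤ obj y ↔ x ≤ y
  arr_le_iff : ∀ g h, arr g ≤ arr h ↔ g ≤ h
  full : ∀ g : G.Arr, G.dom g ∈ Set.range obj → G.cod g ∈ Set.range obj → g ∈ Set.range arr
  isLowerSet_obj : IsLowerSet (Set.range obj)
  isLowerSet_arr : IsLowerSet (Set.range arr)
  exists_iso : ∀ x : G.Obj, ∃ g : G.Arr, G.dom g = x ∧ G.cod g ∈ Set.range obj

/-- The inductive groupoid `G(S)` of an inverse semigroup `S`: its arrows are the elements of `S`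
with the natural partial order, its objects are the idempotents, `s` goes from `s*s` to `ss*`, and
the product is the restricted product of `S`. -/
noncomputable def inductiveGroupoid (S : Type u) [Semigroup S] [IsInverseSemigroup S] :
    OrderedGroupoid.{u} where
  Obj := Idem S
  Arr := S
  arrOrder := naturalOrder S
  dom := domIdem
  cod := codIdem
  one e := e.1
  inv := star
  mul s t _ := s * t
  dom_one e := Idem.ext (by change star e.1 * e.1 = e.1; rw [star_idem e.2, e.2])
  cod_one e := Idem.ext (by change e.1 * star e.1 = e.1; rw [star_idem e.2, e.2])
  dom_mul s t p := Idem.ext (by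
    have hp : star s * s = t * star t := congrArg Idem.val p
    change star (s * t) * (s * t) = star t * t
    rw [star_mul]
    calc star t * star s * (s * t) = star t * ((star s * s) * t) := by simp only [mul_assoc]
      _ = star t * t := by rw [hp, mul_star_mul])
  cod_mul s t p := Idem.ext (by
    have hp : star s * s = t * star t := congrArg Idem.val p
    change (s * t) * star (s * t) = s * star s
    rw [star_mul]
    calc s * t * (star t * star s) = s * (t * star t) * star s := by simp only [mul_assoc]
      _ = s * star s := by rw [← hp, ← mul_assoc s, mul_star_mul])
  dom_inv s := Idem.ext (by change star (star s) * star s = s * star s; rw [star_star])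
  cod_inv s := Idem.ext (by change star s * star (star s) = star s * s; rw [star_star])
  mul_assoc s t r _ _ := mul_assoc s t r
  mul_one s := (mul_assoc _ _ _).symm.trans (mul_star_mul s)
  one_mul s := mul_star_mul s
  mul_inv _ := rfl
  inv_mul _ := rfl
  dom_mono := by
    rintro _ t ⟨e, he, rfl⟩
    have h : star (e * t) * (e * t) = star t * e * t := by
      rw [star_mul, star_idem he]
      calc star t * e * (e * t) = star t * (e * e) * t := by simp only [mul_assoc]
        _ = _ := by rw [he]
    have h1 : star t * e * t * (star t * t) = star t * e * t := by
      rw [mul_assoc, ← mul_assoc t, mul_star_mul]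
    refine ⟨?_, ?_⟩
    · change star (e * t) * (e * t) = star (e * t) * (e * t) * (star t * t)
      rw [h, h1]
    · change star (e * t) * (e * t) = (star t * t) * (star (e * t) * (e * t))
      rw [h, idem_comm (star_mul_self_idem t) (conj_idem he t), h1]
  cod_mono := by
    rintro _ t ⟨e, he, rfl⟩
    have hc := idem_comm (mul_star_self_idem t) he
    have h : (e * t) * star (e * t) = e * (t * star t) := by
      rw [star_mul, star_idem he]
      calc e * t * (star t * e) = e * ((t * star t) * e) := by simp only [mul_assoc]
        _ = (e * e) * (t * star t) := by rw [hc]; simp only [mul_assoc]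
        _ = _ := by rw [he]
    have h1 : e * (t * star t) * (t * star t) = e * (t * star t) := by
      rw [mul_assoc, mul_star_self_idem]
    refine ⟨?_, ?_⟩
    · change (e * t) * star (e * t) = (e * t) * star (e * t) * (t * star t)
      rw [h, h1]
    · change (e * t) * star (e * t) = (t * star t) * ((e * t) * star (e * t))
      rw [h, ← mul_assoc (t * star t), hc, h1]
  one_mono := by
    intro e f h
    obtain ⟨h1, -⟩ := h
    exact ⟨e.1, e.2, h1⟩
  inv_mono := by
    rintro _ t ⟨e, he, rfl⟩
    refine ⟨star t * e * t, conj_idem he t, ?_⟩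
    rw [star_mul, star_idem he]
    calc star t * e = (star t * t * star t) * e := by rw [star_mul_star]
      _ = star t * ((t * star t) * e) := by simp only [mul_assoc]
      _ = star t * e * t * star t := by
        rw [idem_comm (mul_star_self_idem t) he]; simp only [mul_assoc]
  mul_mono := by
    rintro _ _ s t _ _ ⟨e, he, rfl⟩ ⟨f, hf, rfl⟩
    have hq : (s * f * star s) * (s * f * star s) = s * f * star s := by
      simpa only [star_star] using conj_idem hf (star s)
    refine ⟨e * (s * f * star s), idem_mul_idem he hq, ?_⟩
    calc e * s * (f * t) = e * (s * star s * s) * f * t := by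
          rw [mul_star_mul]; simp only [mul_assoc]
      _ = e * s * ((star s * s) * f) * t := by simp only [mul_assoc]
      _ = e * (s * f * star s) * (s * t) := by
        rw [idem_comm (star_mul_self_idem s) hf]; simp only [mul_assoc]
  dom_fibration := by
    intro s x hx
    have hx1 : x.1 = x.1 * (star s * s) := hx.1
    have hx2 : x.1 = (star s * s) * x.1 := hx.2
    refine ⟨s * x.1, ⟨⟨s * x.1 * star s, ?_, ?_⟩, Idem.ext ?_⟩, ?_⟩
    · simpa only [star_star] using conj_idem x.2 (star s)
    · rw [mul_assoc, mul_assoc, ← hx1]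
    · change star (s * x.1) * (s * x.1) = x.1
      rw [star_mul, star_idem x.2]
      calc x.1 * star s * (s * x.1) = x.1 * ((star s * s) * x.1) := by simp only [mul_assoc]
        _ = x.1 := by rw [← hx2, x.2]
    · rintro _ ⟨⟨f, hf, rfl⟩, h⟩
      have h' : star (f * s) * (f * s) = x.1 := congrArg Idem.val h
      rw [star_mul, star_idem hf] at h'
      rw [← h']
      calc f * s = s * (star s * f * s) := (mul_conj hf s).symm
        _ = s * (star s * (f * f) * s) := by rw [hf]
        _ = s * (star s * f * (f * s)) := by simp only [mul_assoc]

/-- Enlargement Morita equivalence: there is an ordered groupoid which is an enlargement of both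
inductive groupoids. -/
def EnlargementMoritaEquivalent (S T : Type u) [Semigroup S] [IsInverseSemigroup S]
    [Semigroup T] [IsInverseSemigroup T] : Prop :=
  ∃ G : OrderedGroupoid.{u}, Nonempty (Enlargement (inductiveGroupoid S) G) ∧
    Nonempty (Enlargement (inductiveGroupoid T) G)

end InverseSemigroup

/-!
The category `L(S)` decides all the notions: each of them turns out to be equivalent to
`L(S) ≌ L(T)`.

*Toposes and unitary sets determine `L(S)`.* An étale set is the presheaf of its fibres over
`E(S)`, an arrow `s : d ⟶ e` of `L(S)` acting by `x ↦ xs`; this gives `𝓑(S) ≌ PSh(L(S))`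
(`etaleEquivalence`). Call an object of a category local if the morphisms into it without a section
all factor through one proper subobject. Equivalences preserve local objects. All idempotent
endomorphisms in `L(S)` are identities, so the local presheaves on `L(S)` are the representable
ones (`isLocalBasis_yoneda`), and `L(S)` is recovered from `PSh(L(S))`. Likewise the local unitary
sets are the right ideals `eS`, and the split monomorphisms between them are the arrows of `L(S)`
(`isLocalBasis_principalFunctor`). Closed sets are the same as unitary sets because idempotents
commute (`RightSet.isClosed_iff_isUnitary`).

*From `L(S) ≌ L(T)` to a joint enlargement.* Every arrow into `e` in `L(S)` is isomorphic to the
inclusion of a unique idempotent below `e`. This property passes to the images of the idempotents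
of `S` in `L(T)`, and so the isomorphisms of `L(T)` between the members of the disjoint union
`E(S) ⊔ E(T)`, ordered by restriction, form an ordered groupoid; it is an enlargement of `G(S)` and
of `G(T)` (`EnlargementMoritaEquivalent.of_lCat`).

*From an enlargement to a biset.* In a joint enlargement `G`, take the arrows from `E(T)` to `E(S)`.
The pseudoproduct of `g` and `h` is the greatest product of composable arrows below `g` and `h`;
where it exists, it is associative, and it exists when the domain of `g` and the codomain of `h` lie
both in `E(S)` or both in `E(T)`. It gives the two actions and the forms `⟨x, y⟩ = xy⁻¹`
and `[x, y] = x⁻¹y` (`ArrowBiset.equivalenceBiset`).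

*From a biset to unitary sets.* Tensoring with an equivalence biset `X` is an equivalence, with
inverse the tensor product with the dual biset, because `y ⊗ x ⊗ x' ↦ y⟨x, x'⟩` is a bijection
`(Y ⊗ X) ⊗ X* → Y` (`EquivalenceBiset.contract_bijective`).
-/

namespace InverseSemigroup

open CategoryTheory MulOpposite
open scoped RightActions

/-! ### Unitary and closed right sets -/

theorem smul_smul_right {S X : Type u} [Semigroup S] [SemigroupAction Sᵐᵒᵖ X] (x : X) (s t : S) :
    (x <• s) <• t = x <• (s * t) :=
  (mul_smul (op t) (op s) x).symm

namespace RightSet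

section

variable {S : Type u} [Semigroup S]

/-- The element `x ⊗ s` of `X ⊗_S S`. -/
def tmul (X : RightSet S) (x : X.carrier) (s : S) : X.Tensor := Quot.mk _ (x, s)

theorem smul_tmul (X : RightSet S) (x : X.carrier) (s t : S) :
    X.tmul (x <• s) t = X.tmul x (s * t) :=
  Quot.sound ⟨x, s, t, rfl, rfl⟩

theorem Hom.map_smul {X Y : RightSet S} (f : X ⟶ Y) (x : X.carrier) (s : S) :
    f.hom (x <• s) = f.hom x <• s :=
  f.hom.map_smul' (op s) x

theorem hom_ext {X Y : RightSet S} {f g : X ⟶ Y} (h : ∀ x, f.hom x = g.hom x) : f = g :=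
  RightSet.Hom.ext (MulActionHom.ext h)

/-- A bijective equivariant map is an isomorphism of right sets. -/
theorem isIso_of_bijective {X Y : RightSet S} (f : X ⟶ Y) (hf : Function.Bijective f.hom) :
    IsIso f := by
  obtain ⟨g, hg₁, hg₂⟩ := Function.bijective_iff_has_inverse.1 hf
  refine ⟨⟨⟨g, fun s y => ?_⟩⟩, hom_ext hg₁, hom_ext hg₂⟩
  apply hf.1
  have h := Hom.map_smul f (g y) s.unop
  rw [hg₂] at h
  exact (hg₂ _).trans h.symm

end

variable {S : Type u} [Semigroup S] [IsInverseSemigroup S]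

/-- Every element of a unitary set is fixed by an idempotent, since `s = s(s*s)`. -/
theorem IsUnitary.exists_idem {X : RightSet S} (hX : X.IsUnitary) (x : X.carrier) :
    ∃ e : S, e * e = e ∧ x <• e = x := by
  obtain ⟨s, y, rfl⟩ := hX x
  exact ⟨star s * s, star_mul_self_idem s, by
    rw [smul_smul_right, ← mul_assoc, mul_star_mul]⟩

/-- The element `x ⊗ e` does not depend on the idempotent `e` fixing `x`, because idempotents
commute. -/
theorem tmul_idem_eq (X : RightSet S) {x : X.carrier} {e f : S} (he : e * e = e) (hf : f * f = f)
    (hxe : x <• e = x) (hxf : x <• f = x) : X.tmul x e = X.tmul x f := by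
  calc X.tmul x e = X.tmul (x <• f) e := by rw [hxf]
    _ = X.tmul (x <• e) f := by rw [smul_tmul, smul_tmul, idem_comm he hf]
    _ = X.tmul x f := by rw [hxe]

/-- Over an inverse semigroup the closed right sets are exactly the unitary ones. -/
theorem isClosed_iff_isUnitary (X : RightSet S) : X.IsClosed ↔ X.IsUnitary := by
  constructor
  · intro h x
    obtain ⟨⟨y, s⟩, hy⟩ := h.2 x
    exact ⟨s, y, hy⟩
  · intro h
    refine ⟨?_, fun x => ?_⟩
    · have key : ∀ (x : X.carrier) (s : S),
          X.tmul x s = X.tmul (x <• s) (star s * s) := fun x s => by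
        rw [smul_tmul, ← mul_assoc, mul_star_mul]
      have hfix : ∀ (x : X.carrier) (s : S), (x <• s) <• (star s * s) = x <• s := fun x s => by
        rw [smul_smul_right, ← mul_assoc, mul_star_mul]
      rintro ⟨x, s⟩ ⟨y, t⟩ hxy
      have hxy : x <• s = y <• t := hxy
      change X.tmul x s = X.tmul y t
      rw [key x s, key y t, ← hxy]
      refine X.tmul_idem_eq (star_mul_self_idem s) (star_mul_self_idem t) (hfix x s) ?_
      rw [hxy]
      exact hfix y t
    · obtain ⟨s, y, rfl⟩ := h x
      exact ⟨X.tmul y s, rfl⟩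

end RightSet

theorem semigroupMoritaEquivalent_iff (S T : Type u) [Semigroup S] [IsInverseSemigroup S]
    [Semigroup T] [IsInverseSemigroup T] :
    SemigroupMoritaEquivalent S T ↔ Nonempty (UnitarySet S ≌ UnitarySet T) := by
  have hS : (fun X : RightSet S => X.IsClosed) = fun X => X.IsUnitary :=
    funext fun X => propext X.isClosed_iff_isUnitary
  have hT : (fun X : RightSet T => X.IsClosed) = fun X => X.IsUnitary :=
    funext fun X => propext X.isClosed_iff_isUnitary
  unfold SemigroupMoritaEquivalent ClosedSet UnitarySet
  rw [hS, hT]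

/-! ### The dual of an equivalence biset -/

section Dual

variable {S T X : Type u} [Semigroup S] [IsInverseSemigroup S]
    [Semigroup T] [IsInverseSemigroup T] [SemigroupAction S X] [SemigroupAction Tᵐᵒᵖ X]
    [SMulCommClass S Tᵐᵒᵖ X]

namespace EquivalenceBiset

theorem l_smul_right (B : EquivalenceBiset S T X) (s : S) (x y : X) :
    B.l x (s • y) = B.l x y * star s := by
  rw [B.l_star (s • y), B.l_smul, star_mul, ← B.l_star]

theorem r_smul_left (B : EquivalenceBiset S T X) (t : T) (x y : X) :
    B.r (x <• t) y = star t * B.r x y := by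
  rw [B.r_star (x <• t), B.r_smul, star_mul, ← B.r_star]

/-- The forms are balanced: `⟨xt, y⟩ = ⟨x, yt*⟩`. -/
theorem l_balanced (B : EquivalenceBiset S T X) (t : T) (x y : X) :
    B.l (x <• t) y = B.l x (y <• star t) := by
  -- Write `t = [a, b]`, so that `xt = ⟨x, a⟩b` and `yt* = ⟨y, b⟩a`.
  obtain ⟨a, b, rfl⟩ := B.r_surjective t
  rw [← B.r_star b a, ← B.l_smul_eq, ← B.l_smul_eq, B.l_smul, B.l_smul_right, ← B.l_star y b]

end EquivalenceBiset

/-- The underlying type of the dual `(T, S)`-biset `X*` of an `(S, T)`-biset `X`. -/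
@[ext]
structure DualBiset (S T X : Type u) where
  val : X

variable (S T X) in
/-- The left action `t · x = xt*` on `X*`. -/
noncomputable instance : SemigroupAction T (DualBiset S T X) where
  smul t x := ⟨x.val <• star t⟩
  mul_smul t t' x := DualBiset.ext (by
    change x.val <• star (t * t') = (x.val <• star t') <• star t
    rw [star_mul, smul_smul_right])

variable (S T X) in
/-- The right action `x · s = s*x` on `X*`. -/
noncomputable instance : SemigroupAction Sᵐᵒᵖ (DualBiset S T X) where
  smul s x := ⟨star s.unop • x.val⟩
  mul_smul s s' x := DualBiset.ext (by
    change star (s'.unop * s.unop) • x.val = star s.unop • star s'.unop • x.val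
    rw [star_mul, mul_smul])

namespace DualBiset

variable {S T X : Type u}

theorem smul_val [Semigroup T] [IsInverseSemigroup T] [SemigroupAction Tᵐᵒᵖ X] (t : T)
    (x : DualBiset S T X) : (t • x).val = x.val <• star t := rfl

theorem rsmul_val [Semigroup S] [IsInverseSemigroup S] [SemigroupAction S X]
    (x : DualBiset S T X) (s : S) : (x <• s).val = star s • x.val := rfl

end DualBiset

instance : SMulCommClass T Sᵐᵒᵖ (DualBiset S T X) where
  smul_comm t s x := DualBiset.ext (smul_comm (star s.unop) (op (star t)) x.val).symm

/-- The dual equivalence biset, in which the two forms are exchanged. -/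
noncomputable def EquivalenceBiset.dual (B : EquivalenceBiset S T X) :
    EquivalenceBiset T S (DualBiset S T X) where
  l x y := B.r x.val y.val
  r x y := B.l x.val y.val
  l_surjective t := by
    obtain ⟨x, y, h⟩ := B.r_surjective t
    exact ⟨⟨x⟩, ⟨y⟩, h⟩
  r_surjective s := by
    obtain ⟨x, y, h⟩ := B.l_surjective s
    exact ⟨⟨x⟩, ⟨y⟩, h⟩
  l_smul t x y := by rw [DualBiset.smul_val, B.r_smul_left, star_star]
  l_star x y := B.r_star _ _
  l_self_smul x := DualBiset.ext (by rw [DualBiset.smul_val, ← B.r_star, B.smul_r_self])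
  r_smul x y s := by rw [DualBiset.rsmul_val, B.l_smul_right, star_star]
  r_star x y := B.l_star _ _
  smul_r_self x := DualBiset.ext (by rw [DualBiset.rsmul_val, ← B.l_star, B.l_self_smul])
  l_smul_eq x y z := DualBiset.ext (by
    rw [DualBiset.smul_val, DualBiset.rsmul_val, ← B.r_star, ← B.l_star, B.l_smul_eq])

end Dual

/-! ### Tensoring with a biset -/

section Tensor

variable {S T X : Type u} [Semigroup S] [Semigroup T] [SemigroupAction S X]
    [SemigroupAction Tᵐᵒᵖ X] [SMulCommClass S Tᵐᵒᵖ X]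

section

variable (X)

/-- The generating relation `(ys, x) ~ (y, sx)` of the tensor product `Y ⊗_S X`. -/
def BisetTensorRel (Y : RightSet S) (a b : Y.carrier × X) : Prop :=
  ∃ (y : Y.carrier) (s : S) (x : X), a = (y <• s, x) ∧ b = (y, s • x)

/-- The right `T`-set `Y ⊗_S X`. -/
def bisetTensor (T : Type u) [Semigroup T] [SemigroupAction Tᵐᵒᵖ X] [SMulCommClass S Tᵐᵒᵖ X]
    (Y : RightSet S) : RightSet T :=
  letI : SemigroupAction Tᵐᵒᵖ (Quot (BisetTensorRel X Y)) :=
    { smul := fun t => Quot.map (fun a => (a.1, t • a.2)) (by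
        rintro _ _ ⟨y, s, x, rfl, rfl⟩
        exact ⟨y, s, t • x, rfl, Prod.ext rfl (smul_comm s t x).symm⟩)
      mul_smul := by
        rintro t t' ⟨y, x⟩
        exact congrArg (fun z => Quot.mk _ (y, z)) (mul_smul t t' x) }
  ⟨Quot (BisetTensorRel X Y)⟩

/-- The element `y ⊗ x` of `Y ⊗_S X`. -/
def btmul {Y : RightSet S} (y : Y.carrier) (x : X) : (bisetTensor X T Y).carrier :=
  Quot.mk _ (y, x)

end

theorem btmul_smul {Y : RightSet S} (y : Y.carrier) (x : X) (t : T) :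
    (btmul X y x : (bisetTensor X T Y).carrier) <• t = btmul X y (x <• t) := rfl

theorem smul_btmul {Y : RightSet S} (y : Y.carrier) (s : S) (x : X) :
    (btmul X (y <• s) x : (bisetTensor X T Y).carrier) = btmul X y (s • x) :=
  Quot.sound ⟨y, s, x, rfl, rfl⟩

theorem btmul_induction {Y : RightSet S} {p : (bisetTensor X T Y).carrier → Prop}
    (h : ∀ y x, p (btmul X y x)) (z) : p z := by
  obtain ⟨y, x⟩ := z
  exact h y x

/-- The map `f ⊗ X`. -/
def bisetTensorMap (X : Type u) [SemigroupAction S X] [SemigroupAction Tᵐᵒᵖ X]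
    [SMulCommClass S Tᵐᵒᵖ X] {Y Z : RightSet S} (f : Y ⟶ Z) :
    bisetTensor X T Y ⟶ bisetTensor X T Z where
  hom :=
    { toFun := Quot.map (fun a => (f.hom a.1, a.2)) (by
        rintro _ _ ⟨y, s, x, rfl, rfl⟩
        exact ⟨f.hom y, s, x, Prod.ext (RightSet.Hom.map_smul f y s) rfl, rfl⟩)
      map_smul' := by
        rintro t ⟨y, x⟩
        rfl }

end Tensor

/-! ### Strongly Morita equivalent semigroups have equivalent categories of unitary sets -/

section Biset

variable {S T X : Type u} [Semigroup S] [IsInverseSemigroup S]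
    [Semigroup T] [IsInverseSemigroup T] [SemigroupAction S X] [SemigroupAction Tᵐᵒᵖ X]
    [SMulCommClass S Tᵐᵒᵖ X]

/-- The functor `Y ↦ Y ⊗_S X` on unitary sets. -/
def EquivalenceBiset.tensorFunctor (B : EquivalenceBiset S T X) :
    UnitarySet S ⥤ UnitarySet T where
  obj Y := ⟨bisetTensor X T Y.obj, btmul_induction fun y x =>
    ⟨B.r x x, btmul X y x, by rw [btmul_smul, B.smul_r_self]⟩⟩
  map f := ObjectProperty.homMk (bisetTensorMap X f.hom)
  map_id Y := by
    ext : 1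
    exact RightSet.hom_ext (btmul_induction fun y x => rfl)
  map_comp f g := by
    ext : 1
    exact RightSet.hom_ext (btmul_induction fun y x => rfl)

/-- The map `(Y ⊗_S X) ⊗_T X* → Y`, `y ⊗ x ⊗ x' ↦ y⟨x, x'⟩`. -/
def EquivalenceBiset.contract (B : EquivalenceBiset S T X) (Y : RightSet S) :
    bisetTensor (DualBiset S T X) S (bisetTensor X T Y) ⟶ Y where
  hom :=
    { toFun := Quot.lift (fun a => Quot.lift (fun b => b.1 <• B.l b.2 a.2.val) (by
          rintro _ _ ⟨y, s, x, rfl, rfl⟩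
          change (y <• s) <• _ = y <• B.l (s • x) _
          rw [smul_smul_right, B.l_smul]) a.1) (by
        rintro _ _ ⟨z, t, x', rfl, rfl⟩
        induction z using btmul_induction with | _ y x
        change y <• B.l (x <• t) x'.val = y <• B.l x (x'.val <• star t)
        rw [B.l_balanced])
      map_smul' := by
        rintro s ⟨z, x'⟩
        induction z using btmul_induction with | _ y x
        change y <• B.l x (star s.unop • x'.val) = (y <• B.l x x'.val) <• s.unop
        rw [smul_smul_right, B.l_smul_right, star_star] }

/-- The contraction `(Y ⊗_S X) ⊗_T X* → Y` is bijective on unitary sets. -/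
theorem EquivalenceBiset.contract_bijective (B : EquivalenceBiset S T X) {Y : RightSet S}
    (hY : Y.IsUnitary) : Function.Bijective (B.contract Y).hom := by
  let t₃ : Y.carrier → X → X → (bisetTensor (DualBiset S T X) S (bisetTensor X T Y)).carrier :=
    fun y x x' => btmul (DualBiset S T X) (btmul X y x : (bisetTensor X T Y).carrier) ⟨x'⟩
  have hleft : ∀ y s x x', t₃ (y <• s) x x' = t₃ y (s • x) x' := fun y s x x' =>
    congrArg (fun z => btmul (DualBiset S T X) z ⟨x'⟩) (smul_btmul y s x)
  have hmid : ∀ y x (t : T) x', t₃ y (x <• t) x' = t₃ y x (x' <• star t) := fun y x t x' =>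
    smul_btmul (X := DualBiset S T X) (btmul X y x : (bisetTensor X T Y).carrier) t ⟨x'⟩
  have hright : ∀ y x x' (s : S), t₃ y x x' <• s = t₃ y x (star s • x') := fun y x x' s => rfl
  have hstar : ∀ a, star (B.l a a) = B.l a a := fun a => (B.l_star a a).symm
  have hidem : ∀ a, B.l a a * B.l a a = B.l a a := fun a => by
    rw [← B.l_smul, B.l_self_smul]
  -- Every element has the form `z ⊗ a ⊗ a` with `z⟨a, a⟩ = z`.
  have hnorm : ∀ y x x', t₃ y x x' = t₃ (y <• B.l x x') x' x' := fun y x x' => by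
    rw [hleft, B.l_smul_eq, hmid, ← B.r_star, B.smul_r_self]
  have hfix : ∀ (y : Y.carrier) x x', (y <• B.l x x') <• B.l x' x' = y <• B.l x x' :=
    fun y x x' => by
      rw [smul_smul_right]
      congr 2
      rw [← hstar x', ← B.l_smul_right, B.l_self_smul]
  -- The elements `z ⊗ a ⊗ a` and `z ⊗ b ⊗ b` are restrictions of each other.
  have hcomp : ∀ (z : Y.carrier) a b, z <• B.l b b = z →
      t₃ z a a = t₃ z b b <• B.l a a := fun z a b hb => by
    calc t₃ z a a = t₃ (z <• B.l b b) a a := by rw [hb]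
      _ = t₃ z b (a <• B.r a b) := by rw [hleft, B.l_smul_eq, hmid, ← B.r_star]
      _ = t₃ z b b <• B.l a a := by rw [hright, ← B.l_smul_eq, hstar]
  have hself : ∀ (z : Y.carrier) a, t₃ z a a <• B.l a a = t₃ z a a := fun z a => by
    rw [hright, hstar, B.l_self_smul]
  have huniq : ∀ (z : Y.carrier) a b, z <• B.l a a = z → z <• B.l b b = z →
      t₃ z a a = t₃ z b b := fun z a b ha hb => by
    calc t₃ z a a = t₃ z b b <• B.l a a := hcomp z a b hb
      _ = (t₃ z a a <• B.l b b) <• B.l a a := by rw [← hcomp z b a ha]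
      _ = (t₃ z a a <• B.l a a) <• B.l b b := by
        rw [smul_smul_right, smul_smul_right, idem_comm (hidem a) (hidem b)]
      _ = t₃ z b b := by rw [hself, ← hcomp z b a ha]
  constructor
  · intro u v huv
    induction u using btmul_induction with | _ u a
    induction u using btmul_induction with | _ y x
    induction v using btmul_induction with | _ v b
    induction v using btmul_induction with | _ w x₁
    have huv : y <• B.l x a.val = w <• B.l x₁ b.val := huv
    change t₃ y x a.val = t₃ w x₁ b.val
    rw [hnorm y, hnorm w, ← huv]
    refine huniq _ _ _ (hfix _ _ _) ?_
    rw [huv]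
    exact hfix _ _ _
  · intro y
    obtain ⟨s, y, rfl⟩ := hY y
    obtain ⟨x, x', rfl⟩ := B.l_surjective s
    exact ⟨t₃ y x x', rfl⟩

/-- Tensoring with `X` and then with `X*` is naturally isomorphic to the identity. -/
noncomputable def EquivalenceBiset.tensorDualIso (B : EquivalenceBiset S T X) :
    B.tensorFunctor ⋙ B.dual.tensorFunctor ≅ 𝟭 (UnitarySet S) :=
  NatIso.ofComponents
    (fun Y => ObjectProperty.isoMk _
      (@asIso _ _ _ _ (B.contract Y.obj) (RightSet.isIso_of_bijective _
        (B.contract_bijective Y.property))))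
    (fun f => by
      ext : 1
      refine RightSet.hom_ext (btmul_induction fun z x' => ?_)
      induction z using btmul_induction with | _ y x
      exact (RightSet.Hom.map_smul f.hom y _).symm)

/-- Tensoring with an equivalence biset is an equivalence of categories. -/
noncomputable def EquivalenceBiset.unitaryEquivalence (B : EquivalenceBiset S T X) :
    UnitarySet S ≌ UnitarySet T :=
  let F := B.tensorFunctor
  let G := B.dual.tensorFunctor
  let H := B.dual.dual.tensorFunctor
  let α : F ⋙ G ≅ 𝟭 _ := B.tensorDualIso
  let β : G ⋙ H ≅ 𝟭 _ := B.dual.tensorDualIso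
  -- The left and the right quasi-inverse of `G` are isomorphic.
  let γ : F ≅ H := F.rightUnitor.symm ≪≫ Functor.isoWhiskerLeft F β.symm ≪≫
    (Functor.associator F G H).symm ≪≫ Functor.isoWhiskerRight α H ≪≫ H.leftUnitor
  CategoryTheory.Equivalence.mk F G α.symm (Functor.isoWhiskerLeft G γ ≪≫ β)

end Biset

theorem StronglyMoritaEquivalent.unitary {S T : Type u} [Semigroup S] [IsInverseSemigroup S]
    [Semigroup T] [IsInverseSemigroup T] (h : StronglyMoritaEquivalent S T) :
    Nonempty (UnitarySet S ≌ UnitarySet T) := by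
  obtain ⟨X, _, _, _, ⟨B⟩⟩ := h
  exact ⟨B.unitaryEquivalence⟩

/-! ### Local objects of a category -/

section Local

universe v₁ v₂ v₃ v₄ u₁ u₂ u₃ u₄

variable {A : Type u₁} [Category.{v₁} A] {B : Type u₂} [Category.{v₂} B]
  {C : Type u₃} [Category.{v₃} C] {D : Type u₄} [Category.{v₄} D]

/-- An object `P` is local if the morphisms into `P` without a section all factor through one
proper subobject of `P`. In a presheaf category the local objects are the retracts of the
representable presheaves. -/
def IsLocalObject (P : C) : Prop :=
  ∃ (M : C) (m : M ⟶ P), Mono m ∧ ¬ IsIso m ∧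
    ∀ ⦃X : C⦄ (f : X ⟶ P), ¬ IsSplitEpi f → ∃ g, g ≫ m = f

theorem IsLocalObject.map {P : C} (h : IsLocalObject P) (E : C ≌ D) :
    IsLocalObject (E.functor.obj P) := by
  obtain ⟨M, m, hm, hiso, hfac⟩ := h
  refine ⟨E.functor.obj M, E.functor.map m, inferInstance, fun hi => ?_, fun X f hf => ?_⟩
  · exact hiso (isIso_of_reflects_iso m E.functor)
  · -- the transpose of `f`
    let g : E.inverse.obj X ⟶ P := E.inverse.map f ≫ E.unitInv.app P
    have hg : E.functor.map g = E.counit.app X ≫ f := by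
      simp [g]
    obtain ⟨k, hk⟩ := hfac g fun hs => by
      obtain ⟨⟨s, hs⟩⟩ := hs
      refine hf ⟨⟨E.functor.map s ≫ E.counit.app X, ?_⟩⟩
      rw [Category.assoc, ← hg, ← E.functor.map_comp, hs, E.functor.map_id]
    refine ⟨E.counitInv.app X ≫ E.functor.map k, ?_⟩
    rw [Category.assoc, ← E.functor.map_comp, hk, hg]
    simp

/-- The functor `y : A ⥤ C` identifies `A` with the category of local objects of `C` and of the
morphisms satisfying `W` between them. -/
structure IsLocalBasis (y : A ⥤ C) (W : MorphismProperty C) : Prop where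
  faithful : y.Faithful
  mem : ∀ {a b : A} (f : a ⟶ b), W (y.map f)
  full : ∀ {a b : A} (g : y.obj a ⟶ y.obj b), W g → ∃ f, y.map f = g
  isLocalObject : ∀ a, IsLocalObject (y.obj a)
  exists_iso : ∀ P, IsLocalObject P → ∃ a, Nonempty (P ≅ y.obj a)

theorem IsLocalBasis.lift_iso {y : A ⥤ C} {W : MorphismProperty C} [W.RespectsIso]
    (h : IsLocalBasis y W) {a b : A} (i : y.obj a ≅ y.obj b) : Nonempty (a ≅ b) := by
  have := h.faithful
  have hW : ∀ {a b : A} (i : y.obj a ≅ y.obj b), W i.hom := fun {a b} i => by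
    have := h.mem (𝟙 a)
    rw [y.map_id] at this
    simpa using MorphismProperty.RespectsIso.postcomp W i.hom _ this
  obtain ⟨f, hf⟩ := h.full i.hom (hW i)
  obtain ⟨g, hg⟩ := h.full i.inv (hW i.symm)
  exact ⟨⟨f, g, y.map_injective (by simp [hf, hg]), y.map_injective (by simp [hf, hg])⟩⟩

/-- An equivalence preserves local objects, so it restricts to an equivalence between the
categories that they form. -/
theorem IsLocalBasis.equivalence {y : A ⥤ C} {V : MorphismProperty C} {z : B ⥤ D}
    {W : MorphismProperty D} [W.RespectsIso] (hy : IsLocalBasis y V) (hz : IsLocalBasis z W)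
    (E : C ≌ D) (hVW : ∀ {P Q : C} (f : P ⟶ Q), W (E.functor.map f) ↔ V f) :
    Nonempty (A ≌ B) := by
  have := hy.faithful
  have := hz.faithful
  choose o ho using fun a => hz.exists_iso _ ((hy.isLocalObject a).map E)
  let φ : ∀ a, E.functor.obj (y.obj a) ≅ z.obj (o a) := fun a => (ho a).some
  have hmap : ∀ {a b : A} (f : a ⟶ b), ∃ g : o a ⟶ o b,
      z.map g = (φ a).inv ≫ E.functor.map (y.map f) ≫ (φ b).hom := fun {a b} f => by
    refine hz.full _ (MorphismProperty.RespectsIso.precomp W _ _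
      (MorphismProperty.RespectsIso.postcomp W _ _ ?_))
    exact (hVW _).2 (hy.mem f)
  choose m hm using @hmap
  let F : A ⥤ B :=
    { obj := o
      map := fun f => m f
      map_id := fun a => z.map_injective (by simp [hm])
      map_comp := fun f g => z.map_injective (by simp [hm]) }
  have : F.Faithful := ⟨fun {a b f g} hfg => by
    have h := (hm f).symm.trans ((congrArg z.map hfg).trans (hm g))
    simpa [y.map_injective_iff, E.functor.map_injective_iff] using h⟩
  have : F.Full := ⟨fun {a b} g => by
    let k := E.functor.preimage ((φ a).hom ≫ z.map g ≫ (φ b).inv)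
    have hk : E.functor.map k = (φ a).hom ≫ z.map g ≫ (φ b).inv := E.functor.map_preimage _
    obtain ⟨f, hf⟩ := hy.full k ((hVW k).1 (by
      rw [hk]
      exact MorphismProperty.RespectsIso.precomp W _ _
        (MorphismProperty.RespectsIso.postcomp W _ _ (hz.mem g))))
    exact ⟨f, z.map_injective ((hm f).trans (by rw [hf, hk]; simp))⟩⟩
  have : F.EssSurj := ⟨fun b => by
    obtain ⟨a, ⟨i⟩⟩ := hy.exists_iso _ ((hz.isLocalObject b).map E.symm)
    exact ⟨a, hz.lift_iso ((φ a).symm ≪≫ E.functor.mapIso i.symm ≪≫ E.counitIso.app (z.obj b))⟩⟩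
  have : F.IsEquivalence := {}
  exact ⟨F.asEquivalence⟩

/-- If the idempotent endomorphisms of a small category are identities, then the representable
presheaves are the local ones. -/
theorem isLocalBasis_yoneda {A : Type u} [SmallCategory A]
    (hA : ∀ (a : A) (f : a ⟶ a), f ≫ f = f → f = 𝟙 a) :
    IsLocalBasis (yoneda : A ⥤ Aᵒᵖ ⥤ Type u) ⊤ where
  faithful := inferInstance
  mem _ := trivial
  full g _ := yoneda.map_surjective g
  isLocalObject a := by
    let M : Subfunctor (yoneda.obj a) :=
      { obj := fun b => {f : b.unop ⟶ a | ¬ IsSplitEpi f}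
        map := fun {b c} i f hf hif => hf (by
          obtain ⟨⟨s, hs⟩⟩ := hif
          exact ⟨⟨s ≫ i.unop, by simpa using hs⟩⟩) }
    refine ⟨M.toFunctor, M.ι, inferInstance, fun hi => ?_, fun X f hf => ?_⟩
    · have hb := (isIso_iff_bijective (M.ι.app (Opposite.op a))).1 inferInstance
      obtain ⟨⟨f, hf⟩, hf'⟩ := hb.2 (𝟙 a)
      have hf' : f = 𝟙 a := hf'
      subst hf'
      exact hf inferInstance
    · refine ⟨Subfunctor.lift f ?_, Subfunctor.lift_ι _ _⟩
      rintro b _ ⟨x, rfl⟩ ⟨⟨s, hs⟩⟩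
      -- a section `s` of the element `f x` yields a section of `f` by Yoneda's lemma
      refine hf ⟨⟨yonedaEquiv.symm (X.map s.op x), yonedaEquiv.injective ?_⟩⟩
      rw [yonedaEquiv_comp, Equiv.apply_symm_apply, NatTrans.naturality_apply]
      exact hs
  exists_iso P hP := by
    obtain ⟨M, m, hm, hiso, hfac⟩ := hP
    have h : ∃ (a : A) (f : yoneda.obj a ⟶ P), IsSplitEpi f := by
      by_contra! hne
      refine hiso ?_
      rw [NatTrans.isIso_iff_isIso_app]
      intro b
      rw [isIso_iff_bijective]
      have : Mono (m.app b) := inferInstance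
      refine ⟨(mono_iff_injective (m.app b)).1 inferInstance, fun x => ?_⟩
      obtain ⟨g, hg⟩ := hfac (yonedaEquiv.symm x) (hne b.unop _)
      refine ⟨yonedaEquiv g, ?_⟩
      have := congrArg yonedaEquiv hg
      rw [Equiv.apply_symm_apply, yonedaEquiv_comp] at this
      exact this
    obtain ⟨a, f, ⟨⟨s, hs⟩⟩⟩ := h
    obtain ⟨r, hr⟩ := yoneda.map_surjective (f ≫ s)
    refine ⟨a, ⟨⟨s, f, hs, ?_⟩⟩⟩
    rw [← hr, hA a r, yoneda.map_id]
    apply yoneda.map_injective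
    rw [yoneda.map_comp, hr, Category.assoc, reassoc_of% hs]

end Local

/-! ### The category `L(S)` inside presheaves and inside unitary sets -/

theorem UnitarySet.isIso_of_bijective {S : Type u} [Semigroup S] {X Y : UnitarySet S} (f : X ⟶ Y)
    (hf : Function.Bijective f.hom.hom) : IsIso f :=
  (ObjectProperty.isIso_hom_iff f).1 (RightSet.isIso_of_bijective f.hom hf)

section LCat

variable {S : Type u} [Semigroup S] [IsInverseSemigroup S]

namespace LCat

theorem hom_ext {d e : LCat S} {s t : d ⟶ e} (h : s.val = t.val) : s = t := LCat.Hom.ext h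

theorem Hom.mul_idem {d e : LCat S} (s : d ⟶ e) : s.val * d.idem.val = s.val := by
  rw [← s.star_mul_self, ← mul_assoc, mul_star_mul]

instance {d e : LCat S} (s : d ⟶ e) : Mono s where
  right_cancellation {c} t t' h := hom_ext (by
    have h : s.val * t.val = s.val * t'.val := congrArg LCat.Hom.val h
    rw [← t.idem_mul, ← t'.idem_mul, ← s.star_mul_self, mul_assoc, h, mul_assoc])

theorem eq_id_of_idempotent (e : LCat S) (f : e ⟶ e) (h : f ≫ f = f) : f = 𝟙 e := by
  rw [← cancel_mono f, h, Category.id_comp]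

end LCat

/-- The right ideal `eS` as a unitary right set. -/
def principal (e : Idem S) : UnitarySet S :=
  letI : SemigroupAction Sᵐᵒᵖ {s : S // e.val * s = s} :=
    { smul := fun t s => ⟨s.1 * t.unop, by rw [← mul_assoc, s.2]⟩
      mul_smul := fun t t' s => Subtype.ext (mul_assoc s.1 t'.unop t.unop).symm }
  ⟨⟨{s : S // e.val * s = s}⟩, fun s => ⟨star s.1 * s.1, s, Subtype.ext (by
    change s.1 * (star s.1 * s.1) = s.1
    rw [← mul_assoc, mul_star_mul])⟩⟩

/-- The equivariant map `eS → X`, `s ↦ xs`, determined by an element `x` of `X`. -/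
def principalMap (e : Idem S) (X : UnitarySet S) (x : X.obj.carrier) : principal e ⟶ X :=
  ObjectProperty.homMk
    { hom :=
      { toFun := fun s => x <• s.1
        map_smul' := fun t s => (smul_smul_right x s.1 t.unop).symm } }

/-- The generator `e` of `eS`. -/
def gen (e : Idem S) : (principal e).obj.carrier := ⟨e.val, e.mul_self⟩

theorem gen_smul {e : Idem S} (s : (principal e).obj.carrier) : gen e <• s.1 = s :=
  Subtype.ext s.2

theorem gen_smul_self (e : Idem S) : gen e <• e.val = gen e := gen_smul (gen e)

theorem principal_hom_apply {e : Idem S} {X : UnitarySet S} (f : principal e ⟶ X)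
    (s : (principal e).obj.carrier) : f.hom.hom s = f.hom.hom (gen e) <• s.1 := by
  rw [← RightSet.Hom.map_smul, gen_smul]

theorem principal_hom_ext {e : Idem S} {X : UnitarySet S} {f g : principal e ⟶ X}
    (h : f.hom.hom (gen e) = g.hom.hom (gen e)) : f = g := by
  ext : 1
  refine RightSet.hom_ext fun s => ?_
  rw [principal_hom_apply f, principal_hom_apply g, h]

theorem principal_hom_gen_smul {e : Idem S} {X : UnitarySet S} (f : principal e ⟶ X) :
    f.hom.hom (gen e) <• e.val = f.hom.hom (gen e) :=
  (principal_hom_apply f (gen e)).symm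

theorem UnitarySet.injective_of_mono {X Y : UnitarySet S} (m : X ⟶ Y) [Mono m] :
    Function.Injective m.hom.hom := by
  -- Elements fixed by a common idempotent `e` are separated, since they correspond to maps
  -- from `eS`.
  have key : ∀ (e : Idem S) (x y : X.obj.carrier), x <• e.val = x → y <• e.val = y →
      m.hom.hom x = m.hom.hom y → x = y := fun e x y hx hy hxy => by
    have h : principalMap e X x ≫ m = principalMap e X y ≫ m := principal_hom_ext (by
      change m.hom.hom (x <• e.val) = m.hom.hom (y <• e.val)
      rw [hx, hy, hxy])
    have h := congrArg (fun f : principal e ⟶ X => f.hom.hom (gen e)) ((cancel_mono m).1 h)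
    change x <• e.val = y <• e.val at h
    rwa [hx, hy] at h
  -- If `x` and `y` have the same image then this image is fixed by the product of the idempotents
  -- fixing `x` and `y`, and so are `x` and `y`.
  have hfix : ∀ (x y : X.obj.carrier) (e f : Idem S), x <• e.val = x → y <• f.val = y →
      m.hom.hom x = m.hom.hom y → x <• f.val = x := fun x y e f hx hy hxy => by
    refine key e _ _ ?_ hx ?_
    · rw [smul_smul_right, idem_comm f.mul_self e.mul_self, ← smul_smul_right, hx]
    · rw [RightSet.Hom.map_smul, hxy, ← RightSet.Hom.map_smul, hy]
  intro x y hxy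
  obtain ⟨e, he, hx⟩ := X.property.exists_idem x
  obtain ⟨f, hf, hy⟩ := X.property.exists_idem y
  exact key ⟨f, hf⟩ x y (hfix x y ⟨e, he⟩ ⟨f, hf⟩ hx hy hxy) hy hxy

namespace UnitarySet

variable {X : UnitarySet S} {p : X.obj.carrier → Prop} (hp : ∀ x (s : S), p x → p (x <• s))

/-- The subset of a unitary set cut out by a predicate stable under the action. -/
def sub (X : UnitarySet S) (p : X.obj.carrier → Prop) (hp : ∀ x (s : S), p x → p (x <• s)) :
    UnitarySet S :=
  letI : SemigroupAction Sᵐᵒᵖ {x // p x} :=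
    { smul := fun s x => ⟨x.1 <• s.unop, hp x.1 s.unop x.2⟩
      mul_smul := fun s t x => Subtype.ext (mul_smul s t x.1) }
  ⟨⟨{x // p x}⟩, fun x => by
    obtain ⟨e, -, he⟩ := X.property.exists_idem x.1
    exact ⟨e, x, Subtype.ext he⟩⟩

/-- The inclusion of a subset stable under the action. -/
def subInclusion : X.sub p hp ⟶ X :=
  ObjectProperty.homMk { hom := { toFun := Subtype.val, map_smul' := fun _ _ => rfl } }

instance : Mono (subInclusion hp) where
  right_cancellation {Z} g h hgh := by
    ext : 1
    refine RightSet.hom_ext fun z => Subtype.ext ?_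
    exact congrArg (fun k : Z ⟶ X => k.hom.hom z) hgh

/-- A morphism whose values satisfy the predicate factors through the subset. -/
theorem exists_subInclusion_fac {Z : UnitarySet S} (f : Z ⟶ X) (hf : ∀ z, p (f.hom.hom z)) :
    ∃ g, g ≫ subInclusion hp = f :=
  ⟨ObjectProperty.homMk { hom :=
    { toFun := fun z => ⟨f.hom.hom z, hf z⟩
      map_smul' := fun s z => Subtype.ext (RightSet.Hom.map_smul f.hom z s.unop) } }, rfl⟩

theorem of_isIso_subInclusion (h : IsIso (subInclusion hp)) (x : X.obj.carrier) : p x := by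
  have hx := congrArg (fun k : X ⟶ X => k.hom.hom x) (IsIso.inv_hom_id (subInclusion hp))
  have hx : ((inv (subInclusion hp)).hom.hom x).1 = x := hx
  rw [← hx]
  exact ((inv (subInclusion hp)).hom.hom x).2

end UnitarySet

variable (S) in
/-- The functor from `L(S)` to unitary sets sending `e` to `eS` and an arrow `s` to left
multiplication by `s`. -/
def principalFunctor : LCat S ⥤ UnitarySet S where
  obj e := principal e.idem
  map s := principalMap _ (principal _) ⟨s.val, s.idem_mul⟩
  map_id e := principal_hom_ext (Subtype.ext e.idem.mul_self)
  map_comp t s := principal_hom_ext (Subtype.ext (mul_assoc s.val t.val _))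

/-- Under a split monomorphism `dS → eS` the generator `d` is sent to an element `s` with
`s*s = d`. -/
theorem star_mul_self_of_isSplitMono {d e : Idem S} (f : principal d ⟶ principal e)
    (hf : IsSplitMono f) :
    star (f.hom.hom (gen d)).1 * (f.hom.hom (gen d)).1 = d.val := by
  obtain ⟨⟨ρ, hρ⟩⟩ := hf
  set s := f.hom.hom (gen d) with hs
  have h₁ : s.1 * d.val = s.1 := congrArg Subtype.val (principal_hom_gen_smul f)
  have h₂ : (ρ.hom.hom (gen e)).1 * s.1 = d.val := by
    have h := congrArg (fun k : principal d ⟶ principal d => (k.hom.hom (gen d)).1) hρ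
    have h' := congrArg Subtype.val (principal_hom_apply ρ s)
    exact h'.symm.trans h
  have h₃ : (star s.1 * s.1) * d.val = star s.1 * s.1 := by rw [mul_assoc, h₁]
  rw [← h₃, ← idem_comm d.mul_self (star_mul_self_idem _), ← h₂, mul_assoc, ← mul_assoc s.1,
    mul_star_mul]

/-- The right ideals `eS` are the local unitary sets, and the arrows of `L(S)` are the split
monomorphisms between them. -/
theorem isLocalBasis_principalFunctor :
    IsLocalBasis (principalFunctor S) (fun _ _ f => IsSplitMono f) where
  faithful := ⟨fun {d e s t} h => LCat.hom_ext (by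
    have h := congrArg (fun k : principal d.idem ⟶ principal e.idem => (k.hom.hom (gen _)).1) h
    exact s.mul_idem.symm.trans (h.trans t.mul_idem))⟩
  mem {d e} s := by
    have hs : d.idem.val * star s.val = star s.val := by
      rw [← s.star_mul_self, star_mul_star]
    refine ⟨⟨principalMap e.idem (principal d.idem) ⟨star s.val, hs⟩,
      principal_hom_ext (Subtype.ext ?_)⟩⟩
    change star s.val * (s.val * d.idem.val) = d.idem.val
    rw [s.mul_idem, s.star_mul_self]
  full {d e} f hf := ⟨⟨(f.hom.hom (gen _)).1, (f.hom.hom (gen _)).2,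
    star_mul_self_of_isSplitMono f hf⟩, principal_hom_ext (principal_hom_gen_smul f)⟩
  isLocalObject a := by
    change IsLocalObject (principal a.idem)
    obtain ⟨e⟩ := a
    -- the elements of `eS` that do not generate it
    let p : (principal e).obj.carrier → Prop := fun s => ∀ t : S, s <• t ≠ gen e
    have hp : ∀ s (t : S), p s → p (s <• t) := fun s t hs t' h => hs (t * t') (by
      rw [← smul_smul_right, h])
    refine ⟨_, UnitarySet.subInclusion hp, inferInstance, fun hi => ?_, fun X f hf =>
      UnitarySet.exists_subInclusion_fac hp f fun x t h => hf ?_⟩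
    · exact UnitarySet.of_isIso_subInclusion hp hi (gen e) e.val (gen_smul_self e)
    · refine ⟨⟨principalMap e X (x <• t), principal_hom_ext ?_⟩⟩
      change f.hom.hom ((x <• t) <• e.val) = gen e
      rw [RightSet.Hom.map_smul, RightSet.Hom.map_smul, h, gen_smul_self]
  exists_iso P hP := by
    obtain ⟨M, m, hm, hiso, hfac⟩ := hP
    have h : ∃ (e : Idem S) (f : principal e ⟶ P), IsSplitEpi f := by
      by_contra! hne
      refine hiso (UnitarySet.isIso_of_bijective m ⟨UnitarySet.injective_of_mono m, fun x => ?_⟩)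
      obtain ⟨e, he, hx⟩ := P.property.exists_idem x
      obtain ⟨g, hg⟩ := hfac (principalMap ⟨e, he⟩ P x) (hne _ _)
      exact ⟨g.hom.hom (gen ⟨e, he⟩), (congrArg (fun k : principal ⟨e, he⟩ ⟶ P =>
        k.hom.hom (gen ⟨e, he⟩)) hg).trans hx⟩
    obtain ⟨e, f, ⟨⟨σ, hσ⟩⟩⟩ := h
    -- The idempotent endomorphism of `eS` with image `P` is multiplication by an idempotent.
    set s := σ.hom.hom (f.hom.hom (gen e)) with hs
    have hfσ : ∀ y, f.hom.hom (σ.hom.hom y) = y := fun y =>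
      congrArg (fun k : P ⟶ P => k.hom.hom y) hσ
    have hσf : ∀ y, σ.hom.hom (f.hom.hom y) = s <• y.1 := fun y => by
      rw [principal_hom_apply f, RightSet.Hom.map_smul]
    have hss : s.1 * s.1 = s.1 := congrArg Subtype.val (by
      rw [← hσf, hs, hfσ] : s <• s.1 = s)
    let i : Idem S := ⟨s.1, hss⟩
    have hi : ∀ y, i.val * (σ.hom.hom y).1 = (σ.hom.hom y).1 := fun y =>
      congrArg Subtype.val (by rw [← hσf, hfσ] : s <• (σ.hom.hom y).1 = σ.hom.hom y)
    have hr : ∀ t : (principal i).obj.carrier, e.val * t.1 = t.1 := fun t => by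
      have h : s.1 * t.1 = t.1 := t.2
      rw [← h, ← mul_assoc, s.2]
    refine ⟨⟨i⟩, ⟨⟨ObjectProperty.homMk { hom :=
      { toFun := fun y => ⟨(σ.hom.hom y).1, hi y⟩
        map_smul' := fun t y => Subtype.ext (by
          have h := congrArg Subtype.val (RightSet.Hom.map_smul σ.hom y t.unop)
          exact h) } },
      principalMap i P (f.hom.hom s), ?_, ?_⟩⟩⟩
    · ext : 1
      refine RightSet.hom_ext fun y => ?_
      change f.hom.hom s <• (σ.hom.hom y).1 = y
      rw [← RightSet.Hom.map_smul, ← hσf, hfσ, hfσ]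
    · refine principal_hom_ext (Subtype.ext ?_)
      change (σ.hom.hom (f.hom.hom s <• s.1)).1 = s.1
      rw [RightSet.Hom.map_smul, hσf]
      change s.1 * s.1 * s.1 = s.1
      rw [hss, hss]

end LCat

theorem lCat_equivalence_of_unitary {S T : Type u} [Semigroup S] [IsInverseSemigroup S]
    [Semigroup T] [IsInverseSemigroup T] (E : UnitarySet S ≌ UnitarySet T) :
    Nonempty (LCat S ≌ LCat T) := by
  have : MorphismProperty.RespectsIso (fun _ _ f => IsSplitMono f :
      MorphismProperty (UnitarySet T)) :=
    MorphismProperty.RespectsIso.mk _ (fun _ _ _ => inferInstance) (fun _ _ _ => inferInstance)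
  refine isLocalBasis_principalFunctor.equivalence isLocalBasis_principalFunctor E
    fun f => ⟨?_, fun _ => inferInstance⟩
  rintro ⟨⟨r, hr⟩⟩
  exact ⟨⟨E.functor.preimage r, E.functor.map_injective (by simpa using hr)⟩⟩

theorem lCat_equivalence_of_presheaf {S T : Type u} [Semigroup S] [IsInverseSemigroup S]
    [Semigroup T] [IsInverseSemigroup T] (E : ((LCat S)ᵒᵖ ⥤ Type u) ≌ ((LCat T)ᵒᵖ ⥤ Type u)) :
    Nonempty (LCat S ≌ LCat T) :=
  (isLocalBasis_yoneda LCat.eq_id_of_idempotent).equivalence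
    (isLocalBasis_yoneda LCat.eq_id_of_idempotent) E fun _ => Iff.rfl

/-! ### Étale sets as presheaves on `L(S)` -/

section Etale

variable {S : Type u} [Semigroup S] [IsInverseSemigroup S]

namespace EtaleSet

theorem Hom.map_smul {X Y : EtaleSet S} (f : X ⟶ Y) (x : X.carrier) (s : S) :
    f.hom (x <• s) = f.hom x <• s :=
  f.hom.map_smul' (op s) x

theorem hom_ext {X Y : EtaleSet S} {f g : X ⟶ Y} (h : ∀ x, f.hom x = g.hom x) : f = g :=
  EtaleSet.Hom.ext (MulActionHom.ext h)

end EtaleSet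

theorem munn_eq_of_hom {d e : LCat S} (s : d ⟶ e) : munn e.idem s.val = d.idem :=
  Idem.ext (by
    change star s.val * e.idem.val * s.val = d.idem.val
    rw [mul_assoc, s.idem_mul, s.star_mul_self])

/-- The arrow `es : s*es ⟶ e` of `L(S)`, along which the element `s` acts on the fibre over `e`
of an étale set. -/
noncomputable def LCat.act (e : Idem S) (s : S) : LCat.mk (munn e s) ⟶ LCat.mk e :=
  LCat.Hom.mk (e.val * s) (by rw [← mul_assoc, e.mul_self]) (by
    change star (e.val * s) * (e.val * s) = star s * e.val * s
    rw [star_mul, star_idem e.mul_self]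
    calc star s * e.val * (e.val * s) = star s * (e.val * e.val) * s := by simp only [mul_assoc]
      _ = star s * e.val * s := by rw [e.mul_self])

variable (S) in
/-- The functor sending an étale set to the presheaf of its fibres, on which an arrow `s : d ⟶ e`
of `L(S)` acts by `x ↦ xs`. -/
noncomputable def fibreFunctor : EtaleSet S ⥤ (LCat S)ᵒᵖ ⥤ Type u where
  obj X :=
    { obj := fun e => {x : X.carrier // X.p x = e.unop.idem}
      map := fun {e d} s => ↾fun x => ⟨x.1 <• s.unop.val, by
        rw [X.p_smul, x.2, munn_eq_of_hom s.unop]⟩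
      map_id := fun e => by
        ext x
        obtain ⟨x, hx⟩ := x
        change x <• e.unop.idem.val = x
        rw [← hx, X.smul_p]
      map_comp := fun s t => by
        ext x
        exact (smul_smul_right x.1 s.unop.val t.unop.val).symm }
  map {X Y} f :=
    { app := fun e => ↾fun x => ⟨f.hom x.1, (f.p_hom x.1).trans x.2⟩
      naturality := fun e d s => by
        ext x
        exact EtaleSet.Hom.map_smul f x.1 s.unop.val }

/-- The element `x` of an étale set in the fibre over `p(x)`. -/
noncomputable def EtaleSet.toFibre (X : EtaleSet S) (x : X.carrier) :
    ((fibreFunctor S).obj X).obj (Opposite.op ⟨X.p x⟩) := ⟨x, rfl⟩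

instance : (fibreFunctor S).Faithful where
  map_injective {X Y f g} h := EtaleSet.hom_ext fun x => by
    have h := congrArg Subtype.val (ConcreteCategory.congr_hom
      (NatTrans.congr_app h (Opposite.op ⟨X.p x⟩)) (X.toFibre x))
    exact h

instance : (fibreFunctor S).Full where
  map_surjective {X Y} f := by
    have hval : ∀ {d e : (LCat S)ᵒᵖ} (x : ((fibreFunctor S).obj X).obj d)
        (y : ((fibreFunctor S).obj X).obj e), x.1 = y.1 → (f.app d x).1 = (f.app e y).1 := by
      rintro ⟨⟨d⟩⟩ ⟨⟨e⟩⟩ ⟨x, hx⟩ ⟨y, hy⟩ h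
      obtain rfl : x = y := h
      obtain rfl : X.p x = d := hx
      obtain rfl : X.p x = e := hy
      rfl
    refine ⟨⟨⟨fun x => (f.app _ (X.toFibre x)).1, fun s x => ?_⟩, fun x =>
      (f.app _ (X.toFibre x)).2⟩, ?_⟩
    · have h := congrArg Subtype.val
        (NatTrans.naturality_apply f (LCat.act (X.p x) s.unop).op (X.toFibre x))
      have h₁ : ∀ (Z : EtaleSet S) (z : ((fibreFunctor S).obj Z).obj (Opposite.op ⟨X.p x⟩)),
          (((fibreFunctor S).obj Z).map (LCat.act (X.p x) s.unop).op z).1 = z.1 <• s.unop :=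
        fun Z z => by
          obtain ⟨z, hz⟩ := z
          have hz : Z.p z = X.p x := hz
          change z <• ((X.p x).val * s.unop) = z <• s.unop
          rw [← smul_smul_right, ← hz, Z.smul_p]
      exact (hval _ _ (h₁ X (X.toFibre x)).symm).trans (h.trans (h₁ Y _))
    · ext e x
      exact Subtype.ext (hval (X.toFibre x.1) x rfl)

section OfPresheaf

variable (F : (LCat S)ᵒᵖ ⥤ Type u)

/-- Two elements of the total space of a presheaf which are images of the same element under the
same element of `S` are equal. -/
theorem sigma_map_eq {e d d' : LCat S} (x : F.obj (Opposite.op e)) (s : d ⟶ e) (s' : d' ⟶ e)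
    (h : s.val = s'.val) :
    (⟨d.idem, F.map s.op x⟩ : Σ e : Idem S, F.obj (Opposite.op ⟨e⟩)) =
      ⟨d'.idem, F.map s'.op x⟩ := by
  obtain ⟨d⟩ := d
  obtain ⟨d'⟩ := d'
  obtain rfl : d = d' := Idem.ext (by
    rw [← s.star_mul_self, ← s'.star_mul_self, h])
  obtain rfl : s = s' := LCat.hom_ext h
  rfl

/-- The étale set of all elements of a presheaf on `L(S)`; it is fibred over `E(S)`, and `s` maps
the fibre over `e` to the fibre over `s*es` by the arrow `es`. -/
noncomputable def etaleOfPresheaf : EtaleSet S :=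
  letI : SemigroupAction Sᵐᵒᵖ (Σ e : Idem S, F.obj (Opposite.op ⟨e⟩)) :=
    { smul := fun s x => ⟨munn x.1 s.unop, F.map (LCat.act x.1 s.unop).op x.2⟩
      mul_smul := fun s t x => by
        have h := sigma_map_eq F x.2 (LCat.act x.1 (t.unop * s.unop))
          (LCat.act (munn x.1 t.unop) s.unop ≫ LCat.act x.1 t.unop) (by
            change x.1.val * (t.unop * s.unop) =
              (x.1.val * t.unop) * (star t.unop * x.1.val * t.unop * s.unop)
            rw [← mul_assoc (x.1.val * t.unop), mul_assoc x.1.val t.unop,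
              mul_conj x.1.mul_self, ← mul_assoc, ← mul_assoc, x.1.mul_self])
        rw [op_comp, F.map_comp] at h
        exact h }
  { carrier := Σ e : Idem S, F.obj (Opposite.op ⟨e⟩)
    p := Sigma.fst
    p_smul := fun _ _ => rfl
    smul_p := fun x => by
      have h := sigma_map_eq F x.2 (LCat.act x.1 x.1.val) (𝟙 (LCat.mk x.1)) x.1.mul_self
      rw [op_id, F.map_id] at h
      exact h }

end OfPresheaf

instance : (fibreFunctor S).EssSurj where
  mem_essImage F := by
    let α : ∀ e : (LCat S)ᵒᵖ, F.obj e → ((fibreFunctor S).obj (etaleOfPresheaf F)).obj e :=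
      fun e y => ⟨⟨e.unop.idem, y⟩, rfl⟩
    have hα : ∀ e, Function.Bijective (α e) := fun e => by
      constructor
      · intro y z h
        exact eq_of_heq (Sigma.mk.inj (congrArg Subtype.val h)).2
      · rintro ⟨⟨d, x⟩, hx⟩
        obtain rfl : d = e.unop.idem := hx
        exact ⟨x, rfl⟩
    refine ⟨etaleOfPresheaf F,
      ⟨(NatIso.ofComponents (fun e => (Equiv.ofBijective (α e) (hα e)).toIso) ?_).symm⟩⟩
    intro e d s
    ext y
    refine Subtype.ext ?_
    exact sigma_map_eq F y s.unop (LCat.act e.unop.idem s.unop.val) s.unop.idem_mul.symm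

instance : (fibreFunctor S).IsEquivalence where

end Etale

/-! ### Ordered groupoids of isomorphisms -/

section System

/-- A poset `P` of objects of a category `D`, with inclusions between comparable ones, such that
each object of `D` is isomorphic to one of `P` and each morphism into an object `x` of `P` is, up
to isomorphism, the inclusion of exactly one element below `x`. -/
structure SubobjectSystem (D : Type u) [Category.{u} D] (P : Type u) [PartialOrder P] where
  obj : P → D
  incl : ∀ {x y : P}, x ≤ y → (obj x ⟶ obj y)
  incl_refl : ∀ x, incl (le_refl x) = 𝟙 (obj x)
  incl_trans : ∀ {x y z : P} (h : x ≤ y) (h' : y ≤ z), incl h ≫ incl h' = incl (h.trans h')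
  mono_incl : ∀ {x y : P} (h : x ≤ y), Mono (incl h)
  existsUnique_fac : ∀ (x : P) (c : D) (m : c ⟶ obj x),
    ∃! y : P, ∃ (h : y ≤ x) (i : c ≅ obj y), i.hom ≫ incl h = m
  exists_iso : ∀ c : D, ∃ x : P, Nonempty (c ≅ obj x)

namespace SubobjectSystem

variable {D : Type u} [Category.{u} D] {P : Type u} [PartialOrder P] (A : SubobjectSystem D P)

/-- An arrow of the groupoid of a system: an isomorphism between two of its objects. -/
structure Arr where
  dom : P
  cod : P
  iso : A.obj dom ≅ A.obj cod

variable {A}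

theorem Arr.ext_hom {x y : P} {i j : A.obj x ≅ A.obj y} (h : i.hom = j.hom) :
    Arr.mk x y i = Arr.mk x y j := by
  rw [Iso.ext h]

/-- The restriction order: `g ≤ h` if `g` and `h` commute with the inclusions. -/
instance : PartialOrder A.Arr where
  le g h := ∃ (p : g.dom ≤ h.dom) (q : g.cod ≤ h.cod), g.iso.hom ≫ A.incl q = A.incl p ≫ h.iso.hom
  le_refl g := ⟨le_rfl, le_rfl, by
    rw [A.incl_refl, A.incl_refl, Category.comp_id, Category.id_comp]⟩
  le_trans := by
    rintro f g h ⟨p, q, e⟩ ⟨p', q', e'⟩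
    refine ⟨p.trans p', q.trans q', ?_⟩
    rw [← A.incl_trans q q', ← A.incl_trans p p', ← Category.assoc, e, Category.assoc, e',
      Category.assoc]
  le_antisymm := by
    rintro ⟨x, y, i⟩ ⟨x', y', j⟩ ⟨p, q, e⟩ ⟨p', q', -⟩
    obtain rfl : x = x' := le_antisymm p p'
    obtain rfl : y = y' := le_antisymm q q'
    refine Arr.ext_hom ?_
    rw [A.incl_refl, A.incl_refl, Category.comp_id, Category.id_comp] at e
    exact e

theorem Arr.mk_le_mk {x y x' y' : P} {i : A.obj x ≅ A.obj y} {j : A.obj x' ≅ A.obj y'} :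
    Arr.mk x y i ≤ Arr.mk x' y' j ↔
      ∃ (p : x ≤ x') (q : y ≤ y'), i.hom ≫ A.incl q = A.incl p ≫ j.hom := Iff.rfl

/-- Composition of arrows. -/
def Arr.mul (g h : A.Arr) (p : g.dom = h.cod) : A.Arr :=
  ⟨h.dom, g.cod, h.iso ≪≫ eqToIso (congrArg A.obj p.symm) ≪≫ g.iso⟩

theorem Arr.mul_mk {x y z : P} (i : A.obj y ≅ A.obj z) (j : A.obj x ≅ A.obj y)
    (p : (Arr.mk y z i).dom = (Arr.mk x y j).cod) :
    Arr.mul (Arr.mk y z i) (Arr.mk x y j) p = Arr.mk x z (j ≪≫ i) :=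
  Arr.ext_hom (by simp)

variable (A) in
/-- The ordered groupoid of isomorphisms between the objects of a system. -/
def groupoid : OrderedGroupoid.{u} where
  Obj := P
  Arr := A.Arr
  dom := Arr.dom
  cod := Arr.cod
  one x := ⟨x, x, Iso.refl _⟩
  inv g := ⟨g.cod, g.dom, g.iso.symm⟩
  mul := Arr.mul
  dom_one _ := rfl
  cod_one _ := rfl
  dom_mul _ _ _ := rfl
  cod_mul _ _ _ := rfl
  dom_inv _ := rfl
  cod_inv _ := rfl
  mul_assoc := by
    rintro ⟨y, z, g⟩ ⟨x, y', h⟩ ⟨w, x', k⟩ p q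
    obtain rfl : y = y' := p
    obtain rfl : x = x' := q
    refine Arr.ext_hom ?_
    simp only [Arr.mul, Iso.trans_hom, Category.assoc]
  mul_one g := Arr.ext_hom (by simp)
  one_mul g := Arr.ext_hom (by simp)
  mul_inv g := Arr.ext_hom (by simp)
  inv_mul g := Arr.ext_hom (by simp)
  dom_mono _ _ h := (Arr.mk_le_mk.1 h).1
  cod_mono _ _ h := (Arr.mk_le_mk.1 h).2.1
  one_mono x y h := Arr.mk_le_mk.2 ⟨h, h, by simp⟩
  inv_mono := by
    rintro ⟨x, y, i⟩ ⟨x', y', j⟩ ⟨p, q, e⟩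
    refine ⟨q, p, ?_⟩
    change i.inv ≫ A.incl p = A.incl q ≫ j.inv
    rw [Iso.inv_comp_eq, ← Category.assoc, Iso.eq_comp_inv]
    exact e.symm
  mul_mono := by
    rintro ⟨y, z, i⟩ ⟨x, y₁, j⟩ ⟨y', z', i'⟩ ⟨x', y₁', j'⟩ r r' ⟨p, q, e⟩ ⟨p₁, q₁, e₁⟩
    obtain rfl : y = y₁ := r
    obtain rfl : y' = y₁' := r'
    rw [Arr.mul_mk, Arr.mul_mk]
    refine ⟨p₁, q, ?_⟩
    change (j.hom ≫ i.hom) ≫ A.incl q = A.incl p₁ ≫ j'.hom ≫ i'.hom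
    have e : i.hom ≫ A.incl q = A.incl p ≫ i'.hom := e
    have e₁ : j.hom ≫ A.incl q₁ = A.incl p₁ ≫ j'.hom := e₁
    rw [Category.assoc, e, reassoc_of% e₁]
  dom_fibration := by
    rintro ⟨z, w, g⟩ x (hx : x ≤ z)
    obtain ⟨y, ⟨hy, i, hi⟩, huniq⟩ := A.existsUnique_fac w _ (A.incl hx ≫ g.hom)
    refine ⟨⟨x, y, i⟩, ⟨⟨hx, hy, hi⟩, rfl⟩, ?_⟩
    rintro ⟨x', y', i'⟩ ⟨⟨p, q, e⟩, r⟩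
    obtain rfl : x' = x := r
    obtain rfl : y' = y := huniq y' ⟨q, i', e⟩
    have := A.mono_incl q
    exact Arr.ext_hom ((cancel_mono (A.incl q)).1 (e.trans hi.symm))

variable (A) in
/-- The image of a system under an equivalence of categories. -/
noncomputable def map {D' : Type u} [Category.{u} D'] (F : D ⥤ D') [F.IsEquivalence] :
    SubobjectSystem D' P where
  obj x := F.obj (A.obj x)
  incl h := F.map (A.incl h)
  incl_refl x := by rw [A.incl_refl, F.map_id]
  incl_trans h h' := by rw [← F.map_comp, A.incl_trans]
  mono_incl h := by
    have := A.mono_incl h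
    infer_instance
  existsUnique_fac x c m := by
    let θ := F.objObjPreimageIso c
    have key : ∀ y : P, (∃ (h : y ≤ x) (i : F.objPreimage c ≅ A.obj y),
        i.hom ≫ A.incl h = F.preimage (θ.hom ≫ m)) ↔
        ∃ (h : y ≤ x) (i : c ≅ F.obj (A.obj y)), i.hom ≫ F.map (A.incl h) = m := by
      refine fun y => exists_congr fun h => ⟨?_, ?_⟩
      · rintro ⟨i, hi⟩
        refine ⟨θ.symm ≪≫ F.mapIso i, ?_⟩
        have hi := congrArg F.map hi
        rw [F.map_comp, F.map_preimage] at hi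
        simp [hi]
      · rintro ⟨i, rfl⟩
        exact ⟨F.preimageIso (θ ≪≫ i), F.map_injective (by simp)⟩
    exact (existsUnique_congr key).1 (A.existsUnique_fac x _ _)
  exists_iso c := by
    obtain ⟨x, ⟨i⟩⟩ := A.exists_iso (F.objPreimage c)
    exact ⟨x, ⟨(F.objObjPreimageIso c).symm ≪≫ F.mapIso i⟩⟩

/-- The disjoint union of two systems in the same category. -/
def sum {Q : Type u} [PartialOrder Q] (A : SubobjectSystem D P) (B : SubobjectSystem D Q) :
    SubobjectSystem D (P ⊕ Q) where
  obj := Sum.elim A.obj B.obj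
  incl {x y} h := match x, y, h with
    | .inl _, .inl _, h => A.incl (Sum.inl_le_inl_iff.1 h)
    | .inr _, .inr _, h => B.incl (Sum.inr_le_inr_iff.1 h)
    | .inl _, .inr _, h => (Sum.not_inl_le_inr h).elim
    | .inr _, .inl _, h => (Sum.not_inr_le_inl h).elim
  incl_refl := by
    rintro (x | x)
    · exact A.incl_refl x
    · exact B.incl_refl x
  incl_trans := by
    rintro (x | x) (y | y) (z | z) h h'
    · exact A.incl_trans _ _
    · exact (Sum.not_inl_le_inr h').elim
    · exact (Sum.not_inl_le_inr h).elim
    · exact (Sum.not_inl_le_inr h).elim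
    · exact (Sum.not_inr_le_inl h).elim
    · exact (Sum.not_inr_le_inl h).elim
    · exact (Sum.not_inr_le_inl h').elim
    · exact B.incl_trans _ _
  mono_incl := by
    rintro (x | x) (y | y) h
    · exact A.mono_incl _
    · exact (Sum.not_inl_le_inr h).elim
    · exact (Sum.not_inr_le_inl h).elim
    · exact B.mono_incl _
  existsUnique_fac := by
    rintro (x | x) c m
    · obtain ⟨y, ⟨h, i, hi⟩, huniq⟩ := A.existsUnique_fac x c m
      refine ⟨.inl y, ⟨Sum.inl_le_inl_iff.2 h, i, hi⟩, ?_⟩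
      rintro (y' | y') ⟨h', i', hi'⟩
      · exact congrArg Sum.inl (huniq y' ⟨Sum.inl_le_inl_iff.1 h', i', hi'⟩)
      · exact (Sum.not_inr_le_inl h').elim
    · obtain ⟨y, ⟨h, i, hi⟩, huniq⟩ := B.existsUnique_fac x c m
      refine ⟨.inr y, ⟨Sum.inr_le_inr_iff.2 h, i, hi⟩, ?_⟩
      rintro (y' | y') ⟨h', i', hi'⟩
      · exact (Sum.not_inl_le_inr h').elim
      · exact congrArg Sum.inr (huniq y' ⟨Sum.inr_le_inr_iff.1 h', i', hi'⟩)
  exists_iso c := by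
    obtain ⟨x, hx⟩ := A.exists_iso c
    exact ⟨.inl x, hx⟩

end SubobjectSystem

end System

/-! ### The inductive groupoid inside a groupoid of isomorphisms -/

section Inductive

variable {S : Type u} [Semigroup S] [IsInverseSemigroup S]

theorem naturalOrder_le_iff (s t : S) : (naturalOrder S).le s t ↔ s = t * (star s * s) := by
  constructor
  · rintro ⟨e, he, rfl⟩
    calc e * t = e * (t * star t) * t := by rw [mul_assoc, mul_star_mul]
      _ = (t * star t) * (e * e) * t := by rw [idem_comm he (mul_star_self_idem t), he]
      _ = t * (star (e * t) * (e * t)) := by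
        rw [star_mul, star_idem he]
        simp only [mul_assoc]
  · intro h
    refine ⟨t * (star s * s) * star t, ?_, ?_⟩
    · simpa only [star_star] using conj_idem (star_mul_self_idem s) (star t)
    · calc s = (t * star t * t) * (star s * s) := by rw [mul_star_mul, ← h]
        _ = t * ((star t * t) * (star s * s)) := by simp only [mul_assoc]
        _ = t * (star s * s) * star t * t := by
          rw [idem_comm (star_mul_self_idem t) (star_mul_self_idem s)]
          simp only [mul_assoc]

/-- An isomorphism `s : d ⟶ e` of `L(S)` satisfies `ss* = e`. -/
theorem LCat.iso_mul_star {d e : LCat S} (i : d ≅ e) :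
    i.hom.val * star i.hom.val = e.idem.val := by
  have h : i.hom.val * i.inv.val = e.idem.val := congrArg LCat.Hom.val i.inv_hom_id
  have h' : (i.hom.val * star i.hom.val) * e.idem.val = e.idem.val := by
    rw [← h, ← mul_assoc, mul_star_mul]
  rw [← h', idem_comm (mul_star_self_idem _) e.idem.mul_self, ← mul_assoc, i.hom.idem_mul]

/-- An element `s` with `s*s = d` and `ss* = e`, as an isomorphism `d ≅ e` of `L(S)`. -/
noncomputable def LCat.isoOf {d e : LCat S} (s : S) (hd : star s * s = d.idem.val)
    (he : s * star s = e.idem.val) : d ≅ e where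
  hom := LCat.Hom.mk s (by rw [← he, mul_star_mul]) hd
  inv := LCat.Hom.mk (star s) (by rw [← hd, star_mul_star]) (by rw [star_star, he])
  hom_inv_id := LCat.hom_ext hd
  inv_hom_id := LCat.hom_ext he

/-- The arrow `d ⟶ e` of `L(S)` given by the idempotent `d ≤ e`. -/
noncomputable def LCat.incl {d e : Idem S} (h : d ≤ e) : LCat.mk d ⟶ LCat.mk e :=
  LCat.Hom.mk d.val h.2.symm (by rw [star_idem d.mul_self, d.mul_self])

variable (S) in
/-- The idempotents of `S` as objects of `L(S)`. An arrow `m : c ⟶ e` factors through the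
idempotent `mm*`. -/
noncomputable def LCat.system : SubobjectSystem (LCat S) (Idem S) where
  obj e := ⟨e⟩
  incl := LCat.incl
  incl_refl _ := rfl
  incl_trans h _ := LCat.hom_ext h.2.symm
  mono_incl _ := inferInstance
  existsUnique_fac x c m := by
    have hle : codIdem m.val ≤ x := by
      have h : x.val * (m.val * star m.val) = m.val * star m.val := by
        rw [← mul_assoc, m.idem_mul]
      refine ⟨?_, h.symm⟩
      change m.val * star m.val = m.val * star m.val * x.val
      rw [idem_comm (mul_star_self_idem _) x.mul_self, h]
    refine ⟨codIdem m.val, ⟨hle, LCat.isoOf m.val m.star_mul_self rfl,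
      LCat.hom_ext (mul_star_mul m.val)⟩, ?_⟩
    rintro y ⟨h, i, rfl⟩
    refine Idem.ext ?_
    change y.val = y.val * i.hom.val * star (y.val * i.hom.val)
    rw [i.hom.idem_mul]
    exact (LCat.iso_mul_star i).symm
  exists_iso c := ⟨c.idem, ⟨Iso.refl _⟩⟩

section Embedding

variable {D : Type u} [Category.{u} D] {P : Type u} [PartialOrder P] {A : SubobjectSystem D P}
  {F : LCat S ⥤ D} {k : Idem S → P} (θ : ∀ e : Idem S, F.obj ⟨e⟩ ≅ A.obj (k e))

/-- The arrow of `A.groupoid` given by an isomorphism of `L(S)`. -/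
noncomputable def embArr {a b : Idem S} (i : LCat.mk a ≅ LCat.mk b) : A.Arr :=
  ⟨k a, k b, (θ a).symm ≪≫ F.mapIso i ≪≫ θ b⟩

theorem embArr_congr {a b a' b' : Idem S} (i : LCat.mk a ≅ LCat.mk b)
    (i' : LCat.mk a' ≅ LCat.mk b') (h : i.hom.val = i'.hom.val) : embArr θ i = embArr θ i' := by
  obtain rfl : a = a' := Idem.ext (by
    have h₁ := i.hom.star_mul_self
    have h₂ := i'.hom.star_mul_self
    rw [h] at h₁
    exact h₁.symm.trans h₂)
  obtain rfl : b = b' := Idem.ext (by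
    have h₁ := LCat.iso_mul_star i
    have h₂ := LCat.iso_mul_star i'
    rw [h] at h₁
    exact h₁.symm.trans h₂)
  rw [Iso.ext (LCat.hom_ext h) (α := i) (β := i')]

/-- The arrow of `A.groupoid` given by an element of `S`. -/
noncomputable def embElt (s : S) : A.Arr :=
  embArr θ (LCat.isoOf (d := ⟨domIdem s⟩) (e := ⟨codIdem s⟩) s rfl rfl)

theorem embElt_eq {a b : Idem S} (i : LCat.mk a ≅ LCat.mk b) :
    embElt θ i.hom.val = embArr θ i :=
  embArr_congr θ _ _ rfl

theorem embElt_one (x : Idem S) : embElt θ x.val = ⟨k x, k x, Iso.refl _⟩ :=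
  (embElt_eq θ (Iso.refl (LCat.mk x))).trans (SubobjectSystem.Arr.ext_hom (by simp))

theorem embArr_mul {a b b' c : Idem S} (i : LCat.mk b ≅ LCat.mk c) (j : LCat.mk a ≅ LCat.mk b')
    (hb : b = b') (q) :
    SubobjectSystem.Arr.mul (embArr θ i) (embArr θ j) q = embElt θ (i.hom.val * j.hom.val) := by
  subst hb
  refine (SubobjectSystem.Arr.mul_mk _ _ _).trans (Eq.trans ?_ (embElt_eq θ (j ≪≫ i)).symm)
  exact SubobjectSystem.Arr.ext_hom (by simp)

/-- Commutation with the inclusions may be checked in `L(S)`. -/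
theorem embArr_comm_iff [F.IsEquivalence] (hk : ∀ x y, k x ≤ k y ↔ x ≤ y)
    (hθ : ∀ (x y : Idem S) (h : x ≤ y), (θ x).hom ≫ A.incl ((hk x y).2 h) =
      F.map (LCat.incl h) ≫ (θ y).hom) {a b a' b' : Idem S} (i : LCat.mk a ≅ LCat.mk b)
    (j : LCat.mk a' ≅ LCat.mk b') (p : a ≤ a') (q : b ≤ b') :
    ((θ a).symm ≪≫ F.mapIso i ≪≫ θ b).hom ≫ A.incl ((hk b b').2 q) =
      A.incl ((hk a a').2 p) ≫ ((θ a').symm ≪≫ F.mapIso j ≪≫ θ b').hom ↔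
    i.hom ≫ LCat.incl q = LCat.incl p ≫ j.hom := by
  have h₁ : ((θ a).symm ≪≫ F.mapIso i ≪≫ θ b).hom ≫ A.incl ((hk b b').2 q) =
      (θ a).inv ≫ F.map (i.hom ≫ LCat.incl q) ≫ (θ b').hom := by
    simp [hθ b b' q]
  have h₂ : A.incl ((hk a a').2 p) ≫ ((θ a').symm ≪≫ F.mapIso j ≪≫ θ b').hom =
      (θ a).inv ≫ F.map (LCat.incl p ≫ j.hom) ≫ (θ b').hom := by
    rw [Iso.eq_inv_comp, ← Category.assoc, hθ a a' p]
    simp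
  rw [h₁, h₂, cancel_epi, cancel_mono, F.map_injective_iff]

theorem embElt_le_iff [F.IsEquivalence] (hk : ∀ x y, k x ≤ k y ↔ x ≤ y)
    (hθ : ∀ (x y : Idem S) (h : x ≤ y), (θ x).hom ≫ A.incl ((hk x y).2 h) =
      F.map (LCat.incl h) ≫ (θ y).hom) (s t : S) :
    embElt θ s ≤ embElt θ t ↔ (naturalOrder S).le s t := by
  have key : ∀ (p : domIdem s ≤ domIdem t) (q : codIdem s ≤ codIdem t),
      (embElt θ s).iso.hom ≫ A.incl ((hk _ _).2 q) =
        A.incl ((hk _ _).2 p) ≫ (embElt θ t).iso.hom ↔ s = t * (star s * s) := fun p q => by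
    refine (embArr_comm_iff θ hk hθ _ _ p q).trans ⟨fun h => ?_, fun h => LCat.hom_ext ?_⟩
    · exact (mul_star_mul s).symm.trans (congrArg LCat.Hom.val h)
    · exact (mul_star_mul s).trans h
  rw [naturalOrder_le_iff]
  constructor
  · rintro ⟨p, q, e⟩
    exact (key ((hk _ _).1 p) ((hk _ _).1 q)).1 e
  · intro h
    have p : domIdem s ≤ domIdem t :=
      (inductiveGroupoid S).dom_mono ((naturalOrder_le_iff s t).2 h)
    have q : codIdem s ≤ codIdem t :=
      (inductiveGroupoid S).cod_mono ((naturalOrder_le_iff s t).2 h)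
    exact ⟨(hk _ _).2 p, (hk _ _).2 q, (key p q).2 h⟩

/-- If `F : L(S) ⥤ D` is an equivalence which identifies the idempotents of `S` with a lower subset
of the objects of a system in `D`, then the groupoid of the system is an enlargement
of `G(S)`. -/
noncomputable def enlargementOfSystem [F.IsEquivalence] (hk : ∀ x y, k x ≤ k y ↔ x ≤ y)
    (hlower : IsLowerSet (Set.range k))
    (hθ : ∀ (x y : Idem S) (h : x ≤ y), (θ x).hom ≫ A.incl ((hk x y).2 h) =
      F.map (LCat.incl h) ≫ (θ y).hom) :
    Enlargement (inductiveGroupoid S) A.groupoid :=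
  have hfull : ∀ g : A.Arr, g.dom ∈ Set.range k → g.cod ∈ Set.range k →
      g ∈ Set.range (embElt θ) := by
    rintro ⟨_, _, g⟩ ⟨a, rfl⟩ ⟨b, rfl⟩
    refine ⟨(F.preimageIso (θ a ≪≫ g ≪≫ (θ b).symm)).hom.val, (embElt_eq θ _).trans ?_⟩
    exact SubobjectSystem.Arr.ext_hom (by simp)
  { obj := k
    arr := (embElt θ : S → A.Arr)
    dom_arr := fun _ => rfl
    cod_arr := fun _ => rfl
    arr_one := embElt_one θ
    arr_mul := fun (g h : S) p q => (embArr_mul θ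
      (LCat.isoOf (S := S) (d := ⟨domIdem g⟩) (e := ⟨codIdem g⟩) g rfl rfl)
      (LCat.isoOf (S := S) (d := ⟨domIdem h⟩) (e := ⟨codIdem h⟩) h rfl rfl) p q).symm
    obj_le_iff := hk
    arr_le_iff := fun s t => embElt_le_iff θ hk hθ s t
    full := hfull
    isLowerSet_obj := hlower
    isLowerSet_arr := by
      rintro g h hle ⟨s, rfl⟩
      exact hfull h (hlower (A.groupoid.dom_mono hle) ⟨_, rfl⟩)
        (hlower (A.groupoid.cod_mono hle) ⟨_, rfl⟩)
    exists_iso := fun x => by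
      let e := F.objPreimage (A.obj x)
      exact ⟨⟨x, k e.idem, (F.objObjPreimageIso (A.obj x)).symm ≪≫ θ e.idem⟩, rfl, _, rfl⟩ }

end Embedding

end Inductive

/-- An equivalence between `L(S)` and `L(T)` provides a joint enlargement of `G(S)` and `G(T)`:
the groupoid of isomorphisms of `L(T)` between the idempotents of `T` and the images of those
of `S`. -/
theorem EnlargementMoritaEquivalent.of_lCat {S T : Type u} [Semigroup S] [IsInverseSemigroup S]
    [Semigroup T] [IsInverseSemigroup T] (E : LCat S ≌ LCat T) :
    EnlargementMoritaEquivalent S T := by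
  let A : SubobjectSystem (LCat T) (Idem S ⊕ Idem T) :=
    ((LCat.system S).map E.functor).sum (LCat.system T)
  refine ⟨A.groupoid,
    ⟨enlargementOfSystem (A := A) (F := E.functor) (k := Sum.inl) (fun _ => Iso.refl _)
      (fun _ _ => Sum.inl_le_inl_iff) ?_
      (fun _ _ _ => (Category.id_comp _).trans (Category.comp_id _).symm)⟩,
    ⟨enlargementOfSystem (A := A) (F := 𝟭 _) (k := Sum.inr) (fun _ => Iso.refl _)
      (fun _ _ => Sum.inr_le_inr_iff) ?_
      (fun _ _ _ => (Category.id_comp _).trans (Category.comp_id _).symm)⟩⟩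
  · rintro _ (y | y) h ⟨x, rfl⟩
    · exact ⟨y, rfl⟩
    · exact (Sum.not_inr_le_inl h).elim
  · rintro _ (y | y) h ⟨x, rfl⟩
    · exact (Sum.not_inl_le_inr h).elim
    · exact ⟨y, rfl⟩

/-! ### The pseudoproduct of an ordered groupoid -/

namespace OrderedGroupoid

variable {G : OrderedGroupoid.{u}}

theorem mul_congr {g g' h h' : G.Arr} (hg : g = g') (hh : h = h') (p : G.dom g = G.cod h)
    (p' : G.dom g' = G.cod h') : G.mul g h p = G.mul g' h' p' := by
  subst hg hh
  rfl

theorem one_mul_of_eq {g e : G.Arr} (he : e = G.one (G.cod g)) (p : G.dom e = G.cod g) :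
    G.mul e g p = g :=
  (mul_congr he rfl p (G.dom_one _)).trans (G.one_mul g)

theorem mul_one_of_eq {g e : G.Arr} (he : e = G.one (G.dom g)) (p : G.dom g = G.cod e) :
    G.mul g e p = g :=
  (mul_congr rfl he p (G.cod_one _).symm).trans (G.mul_one g)

theorem eq_inv {g h : G.Arr} {p : G.dom g = G.cod h} (hgh : G.mul g h p = G.one (G.cod g)) :
    h = G.inv g := by
  have hm : G.mul (G.inv g) g (G.dom_inv g) = G.one (G.cod h) := by rw [G.inv_mul, p]
  have h₁ := G.mul_assoc (G.inv g) g h (G.dom_inv g) p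
  rw [one_mul_of_eq hm] at h₁
  rw [h₁]
  exact mul_one_of_eq (by rw [hgh, G.dom_inv]) _

theorem inv_inv (g : G.Arr) : G.inv (G.inv g) = g :=
  (eq_inv (p := G.dom_inv g) (by rw [G.inv_mul, G.cod_inv])).symm

theorem inv_mul_rev (g h : G.Arr) (p : G.dom g = G.cod h) :
    G.inv (G.mul g h p) = G.mul (G.inv h) (G.inv g)
      ((G.dom_inv h).trans (p.symm.trans (G.cod_inv g).symm)) := by
  refine (eq_inv (p := ?_) ?_).symm
  · rw [G.dom_mul, G.cod_mul, G.cod_inv]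
  · have q : G.dom (G.inv h) = G.cod (G.inv g) :=
      (G.dom_inv h).trans (p.symm.trans (G.cod_inv g).symm)
    rw [G.mul_assoc g h _ p (by rw [G.cod_mul, G.cod_inv])]
    refine Eq.trans ?_ ((G.mul_inv g).trans (congrArg G.one (G.cod_mul g h p).symm))
    refine mul_congr rfl ?_ _ _
    rw [← G.mul_assoc h (G.inv h) (G.inv g) (G.cod_inv h).symm q]
    exact one_mul_of_eq (by rw [G.mul_inv, G.cod_inv, p]) _

theorem inv_le_inv {g h : G.Arr} : G.inv g ≤ G.inv h ↔ g ≤ h :=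
  ⟨fun hgh => by simpa only [inv_inv] using G.inv_mono hgh, fun hgh => G.inv_mono hgh⟩

theorem exists_restrict (g : G.Arr) {x : G.Obj} (hx : x ≤ G.dom g) : ∃ h ≤ g, G.dom h = x :=
  (G.dom_fibration g x hx).exists

theorem exists_corestrict (g : G.Arr) {x : G.Obj} (hx : x ≤ G.cod g) : ∃ h ≤ g, G.cod h = x := by
  obtain ⟨h, hle, hd⟩ := exists_restrict (G.inv g) (hx.trans_eq (G.dom_inv g).symm)
  refine ⟨G.inv h, ?_, (G.cod_inv h).trans hd⟩
  rw [← inv_le_inv, inv_inv]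
  exact hle

theorem eq_of_dom_eq {g h k : G.Arr} (hg : g ≤ k) (hh : h ≤ k) (hd : G.dom g = G.dom h) : g = h :=
  (G.dom_fibration k (G.dom g) (G.dom_mono hg)).unique ⟨hg, rfl⟩ ⟨hh, hd.symm⟩

theorem le_of_dom_le {g h k : G.Arr} (hg : g ≤ k) (hh : h ≤ k) (hd : G.dom g ≤ G.dom h) :
    g ≤ h := by
  obtain ⟨h', hle, hd'⟩ := exists_restrict h hd
  rwa [eq_of_dom_eq hg (hle.trans hh) hd'.symm]

theorem le_of_cod_le {g h k : G.Arr} (hg : g ≤ k) (hh : h ≤ k) (hd : G.cod g ≤ G.cod h) :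
    g ≤ h :=
  inv_le_inv.1 (le_of_dom_le (inv_le_inv.2 hg) (inv_le_inv.2 hh) (by
    rw [G.dom_inv, G.dom_inv]
    exact hd))

/-- An arrow below a product is the product of restrictions of the factors. -/
theorem exists_of_le_mul {g h k : G.Arr} {p : G.dom g = G.cod h} (hk : k ≤ G.mul g h p) :
    ∃ g' ≤ g, ∃ h' ≤ h, ∃ p' : G.dom g' = G.cod h', G.mul g' h' p' = k := by
  have hd : G.dom k ≤ G.dom h := (G.dom_mono hk).trans_eq (G.dom_mul g h p)
  obtain ⟨h', hh', hdh⟩ := exists_restrict h hd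
  obtain ⟨g', hg', hdg⟩ := exists_restrict g ((G.cod_mono hh').trans_eq p.symm)
  exact ⟨g', hg', h', hh', hdg, eq_of_dom_eq (G.mul_mono _ _ _ _ hdg p hg' hh') hk
    ((G.dom_mul _ _ _).trans hdh)⟩

/-- The arrow `k` is the pseudoproduct of `g` and `h`: the greatest among the products `g'h'` of
composable arrows `g' ≤ g` and `h' ≤ h`. -/
def IsProd (g h k : G.Arr) : Prop :=
  IsGreatest {x | ∃ g' ≤ g, ∃ h' ≤ h, ∃ p : G.dom g' = G.cod h', G.mul g' h' p = x} k

theorem IsProd.le {g h k g' h' : G.Arr} (hk : IsProd g h k) (hg : g' ≤ g) (hh : h' ≤ h)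
    (p : G.dom g' = G.cod h') : G.mul g' h' p ≤ k :=
  hk.2 ⟨g', hg, h', hh, p, rfl⟩

theorem IsProd.unique {g h k k' : G.Arr} (hk : IsProd g h k) (hk' : IsProd g h k') : k = k' :=
  IsGreatest.unique hk hk'

theorem IsProd.dom_le {g h k : G.Arr} (hk : IsProd g h k) : G.dom k ≤ G.dom h := by
  obtain ⟨⟨g', -, h', hh, p, rfl⟩, -⟩ := hk
  exact (G.dom_mul _ _ _).trans_le (G.dom_mono hh)

theorem IsProd.cod_le {g h k : G.Arr} (hk : IsProd g h k) : G.cod k ≤ G.cod g := by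
  obtain ⟨⟨g', hg, h', -, p, rfl⟩, -⟩ := hk
  exact (G.cod_mul _ _ _).trans_le (G.cod_mono hg)

theorem isProd_mul (g h : G.Arr) (p : G.dom g = G.cod h) : IsProd g h (G.mul g h p) :=
  ⟨⟨g, le_rfl, h, le_rfl, p, rfl⟩, by
    rintro _ ⟨g', hg, h', hh, p', rfl⟩
    exact G.mul_mono _ _ _ _ p' p hg hh⟩

theorem IsProd.inv {g h k : G.Arr} (hk : IsProd g h k) :
    IsProd (G.inv h) (G.inv g) (G.inv k) := by
  constructor
  · obtain ⟨⟨g', hg, h', hh, p, rfl⟩, -⟩ := hk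
    exact ⟨G.inv h', G.inv_mono hh, G.inv g', G.inv_mono hg, _, (inv_mul_rev g' h' p).symm⟩
  · rintro _ ⟨h', hh, g', hg, p, rfl⟩
    rw [← inv_le_inv, inv_inv, inv_mul_rev]
    refine hk.le ?_ ?_ _
    · rwa [← inv_le_inv, inv_inv]
    · rwa [← inv_le_inv, inv_inv]

/-- The pseudoproduct is associative: both triple products are the greatest product of three
composable arrows below the given ones. -/
theorem IsProd.assoc {g h l k q r r' : G.Arr} (hk : IsProd g h k) (hr : IsProd k l r)
    (hq : IsProd h l q) (hr' : IsProd g q r') : r = r' := by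
  apply le_antisymm
  · obtain ⟨k', hk', l', hl', p, rfl⟩ := hr.1
    obtain ⟨g₀, hg₀, h₀, hh₀, p₀, rfl⟩ := hk.1
    obtain ⟨g₁, hg₁, h₁, hh₁, p₁, rfl⟩ := exists_of_le_mul hk'
    have p₂ : G.dom h₁ = G.cod l' := (G.dom_mul _ _ _).symm.trans p
    rw [G.mul_assoc g₁ h₁ l' p₁ p₂]
    exact hr'.le (hg₁.trans hg₀) (hq.le (hh₁.trans hh₀) hl' p₂) _
  · obtain ⟨g', hg', q', hq', p, rfl⟩ := hr'.1
    obtain ⟨h₀, hh₀, l₀, hl₀, p₀, rfl⟩ := hq.1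
    obtain ⟨h₁, hh₁, l₁, hl₁, p₁, rfl⟩ := exists_of_le_mul hq'
    have p₂ : G.dom g' = G.cod h₁ := p.trans (G.cod_mul _ _ _)
    rw [← G.mul_assoc g' h₁ l₁ p₂ p₁]
    exact hr.le (hk.le hg' (hh₁.trans hh₀) p₂) (hl₁.trans hl₀) _

theorem exists_isProd {g h : G.Arr} {m : G.Obj} (hm : IsGLB {G.dom g, G.cod h} m) :
    ∃ k, IsProd g h k := by
  have hmg : m ≤ G.dom g := hm.1 (by simp)
  have hmh : m ≤ G.cod h := hm.1 (by simp)
  obtain ⟨g', hg', hdg⟩ := exists_restrict g hmg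
  obtain ⟨h', hh', hch⟩ := exists_corestrict h hmh
  refine ⟨G.mul g' h' (hdg.trans hch.symm), ⟨g', hg', h', hh', _, rfl⟩, ?_⟩
  rintro _ ⟨g₁, hg₁, h₁, hh₁, p, rfl⟩
  have hle : G.dom g₁ ≤ m := hm.2 (by
    rintro _ (rfl | rfl)
    · exact G.dom_mono hg₁
    · exact p.trans_le (G.cod_mono hh₁))
  exact G.mul_mono _ _ _ _ p _ (le_of_dom_le hg₁ hg' (hle.trans_eq hdg.symm))
    (le_of_cod_le hh₁ hh' ((p.symm.trans_le hle).trans_eq hch.symm))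

end OrderedGroupoid

/-! ### The biset of arrows between two inductive groupoids -/

section Arrows

open OrderedGroupoid (IsProd isProd_mul)

theorem naturalOrder_mul_le {S : Type u} [Semigroup S] [IsInverseSemigroup S] {s t s' t' : S}
    (hs : (naturalOrder S).le s' s) (ht : (naturalOrder S).le t' t) :
    (naturalOrder S).le (s' * t') (s * t) := by
  obtain ⟨e, he, rfl⟩ := hs
  obtain ⟨f, hf, rfl⟩ := ht
  have hq : (s * f * star s) * (s * f * star s) = s * f * star s := by
    simpa only [star_star] using conj_idem hf (star s)
  refine ⟨e * (s * f * star s), idem_mul_idem he hq, ?_⟩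
  calc e * s * (f * t) = e * (s * star s * s) * f * t := by
        rw [mul_star_mul]; simp only [mul_assoc]
    _ = e * s * ((star s * s) * f) * t := by simp only [mul_assoc]
    _ = e * (s * f * star s) * (s * t) := by
      rw [idem_comm (star_mul_self_idem s) hf]; simp only [mul_assoc]

section Enlargement

variable {S : Type u} [Semigroup S] [IsInverseSemigroup S] {G : OrderedGroupoid.{u}}
  (a : Enlargement (inductiveGroupoid S) G)

/-- The arrow of an enlargement of `G(S)` given by an element of `S`. -/
def Enlargement.elt (s : S) : G.Arr := a.arr s

/-- The object of an enlargement of `G(S)` given by an idempotent of `S`. -/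
def Enlargement.idem (e : Idem S) : G.Obj := a.obj e

namespace Enlargement

theorem idem_injective : Function.Injective a.idem := fun x y h =>
  le_antisymm ((a.obj_le_iff x y).1 h.le) ((a.obj_le_iff y x).1 h.ge)

theorem elt_injective : Function.Injective a.elt := fun x y h =>
  (inductiveGroupoid S).arrOrder.le_antisymm _ _ ((a.arr_le_iff x y).1 h.le)
    ((a.arr_le_iff y x).1 h.ge)

theorem dom_elt (s : S) : G.dom (a.elt s) = a.idem (domIdem s) := a.dom_arr s

theorem cod_elt (s : S) : G.cod (a.elt s) = a.idem (codIdem s) := a.cod_arr s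

theorem elt_idem (e : Idem S) : a.elt e.val = G.one (a.idem e) := a.arr_one e

theorem mul_elt (s t : S) (p : G.dom (a.elt s) = G.cod (a.elt t)) :
    G.mul (a.elt s) (a.elt t) p = a.elt (s * t) :=
  (a.arr_mul s t (a.idem_injective ((a.dom_elt s).symm.trans (p.trans (a.cod_elt t)))) p).symm

theorem elt_le_iff (s t : S) : a.elt s ≤ a.elt t ↔ (naturalOrder S).le s t := a.arr_le_iff s t

theorem exists_elt_of_le {g : G.Arr} {s : S} (h : g ≤ a.elt s) : ∃ s', a.elt s' = g :=
  a.isLowerSet_arr h ⟨s, rfl⟩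

theorem inv_elt (s : S) : G.inv (a.elt s) = a.elt (star s) := by
  have p : G.dom (a.elt s) = G.cod (a.elt (star s)) := by
    rw [a.dom_elt, a.cod_elt]
    exact congrArg a.idem (Idem.ext (by
      change star s * s = star s * star (star s)
      rw [star_star]))
  refine (OrderedGroupoid.eq_inv (p := p) ?_).symm
  rw [a.mul_elt, a.cod_elt, ← a.elt_idem]
  rfl

/-- In an enlargement of `G(S)`, the pseudoproduct of elements of `S` is their product in `S`. -/
theorem isProd_elt (s t : S) : IsProd (a.elt s) (a.elt t) (a.elt (s * t)) := by
  constructor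
  · have hidem := idem_comm (star_mul_self_idem s) (mul_star_self_idem t)
    have p : G.dom (a.elt (s * (t * star t))) = G.cod (a.elt ((star s * s) * t)) := by
      rw [a.dom_elt, a.cod_elt]
      refine congrArg a.idem (Idem.ext ?_)
      change star (s * (t * star t)) * (s * (t * star t)) =
        ((star s * s) * t) * star ((star s * s) * t)
      rw [star_mul, star_mul _ t, star_idem (mul_star_self_idem t),
        star_idem (star_mul_self_idem s)]
      calc t * star t * star s * (s * (t * star t))
          = (t * star t) * (star s * s) * (t * star t) := by simp only [mul_assoc]
        _ = (star s * s) * ((t * star t) * (t * star t)) := by rw [← hidem, mul_assoc]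
        _ = (star s * s) * (star s * s) * (t * star t) := by
          rw [mul_star_self_idem, star_mul_self_idem]
        _ = (star s * s) * ((star s * s) * (t * star t)) := by rw [mul_assoc]
        _ = star s * s * t * (star t * (star s * s)) := by
          rw [hidem]
          simp only [mul_assoc]
    refine ⟨_, ?_, _, ?_, p, ?_⟩
    · rw [a.elt_le_iff]
      refine ⟨s * (t * star t) * star s, ?_, ?_⟩
      · simpa only [star_star] using conj_idem (mul_star_self_idem t) (star s)
      · calc s * (t * star t) = (s * star s * s) * (t * star t) := by rw [mul_star_mul]
          _ = s * ((star s * s) * (t * star t)) := by simp only [mul_assoc]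
          _ = s * (t * star t) * star s * s := by
            rw [hidem]
            simp only [mul_assoc]
    · rw [a.elt_le_iff]
      exact ⟨star s * s, star_mul_self_idem s, rfl⟩
    · rw [a.mul_elt]
      congr 1
      calc s * (t * star t) * (star s * s * t) = s * ((t * star t) * (star s * s)) * t := by
            simp only [mul_assoc]
        _ = (s * star s * s) * (t * star t * t) := by
          rw [← hidem]
          simp only [mul_assoc]
        _ = s * t := by rw [mul_star_mul, mul_star_mul]
  · rintro _ ⟨g, hg, h, hh, p, rfl⟩
    obtain ⟨s', rfl⟩ := a.exists_elt_of_le hg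
    obtain ⟨t', rfl⟩ := a.exists_elt_of_le hh
    rw [a.mul_elt, a.elt_le_iff]
    exact naturalOrder_mul_le ((a.elt_le_iff _ _).1 hg) ((a.elt_le_iff _ _).1 hh)

/-- Pseudoproducts over objects in `E(S)` exist, because idempotents have meets. -/
theorem exists_isProd {g h : G.Arr} (hg : G.dom g ∈ Set.range a.idem)
    (hh : G.cod h ∈ Set.range a.idem) : ∃ k, IsProd g h k := by
  obtain ⟨e, he⟩ := hg
  obtain ⟨f, hf⟩ := hh
  have hc := idem_comm e.mul_self f.mul_self
  refine OrderedGroupoid.exists_isProd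
    (m := a.idem ⟨e.val * f.val, idem_mul_idem e.mul_self f.mul_self⟩) ⟨?_, fun x hx => ?_⟩
  · rintro _ (rfl | rfl)
    · rw [← he]
      refine (a.obj_le_iff _ _).2 ⟨?_, ?_⟩
      · change e.val * f.val = e.val * f.val * e.val
        rw [hc, mul_assoc, e.mul_self]
      · change e.val * f.val = e.val * (e.val * f.val)
        rw [← mul_assoc, e.mul_self]
    · rw [← hf]
      refine (a.obj_le_iff _ _).2 ⟨?_, ?_⟩
      · change e.val * f.val = e.val * f.val * f.val
        rw [mul_assoc, f.mul_self]
      · change e.val * f.val = f.val * (e.val * f.val)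
        rw [hc, ← mul_assoc, f.mul_self]
  · have hxe : x ≤ a.idem e := (hx (by simp)).trans_eq he.symm
    have hxf : x ≤ a.idem f := (hx (by simp)).trans_eq hf.symm
    obtain ⟨d, rfl⟩ : x ∈ Set.range a.idem := a.isLowerSet_obj hxe ⟨e, rfl⟩
    have h₁ : d ≤ e := (a.obj_le_iff d e).1 hxe
    have h₂ : d ≤ f := (a.obj_le_iff d f).1 hxf
    refine (a.obj_le_iff _ _).2 ⟨?_, ?_⟩
    · change d.val = d.val * (e.val * f.val)
      rw [← mul_assoc, ← h₁.1, ← h₂.1]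
    · change d.val = e.val * f.val * d.val
      rw [mul_assoc, ← h₂.2, ← h₁.2]

theorem mem_range_of_le {x y : G.Obj} (h : x ≤ y) (hy : y ∈ Set.range a.idem) :
    x ∈ Set.range a.idem := a.isLowerSet_obj h hy

theorem exists_elt {g : G.Arr} (hd : G.dom g ∈ Set.range a.idem)
    (hc : G.cod g ∈ Set.range a.idem) : ∃ s, a.elt s = g := a.full g hd hc

end Enlargement

end Enlargement

variable {S T : Type u} [Semigroup S] [IsInverseSemigroup S] [Semigroup T] [IsInverseSemigroup T]
  {G : OrderedGroupoid.{u}} (a : Enlargement (inductiveGroupoid S) G)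
  (b : Enlargement (inductiveGroupoid T) G)

/-- The arrows of a joint enlargement from an idempotent of `T` to an idempotent of `S`. -/
structure ArrowBiset where
  arr : G.Arr
  cod_mem : G.cod arr ∈ Set.range a.idem
  dom_mem : G.dom arr ∈ Set.range b.idem

namespace ArrowBiset

variable {a b}

theorem ext_arr {x y : ArrowBiset a b} (h : x.arr = y.arr) : x = y := by
  cases x
  cases y
  cases h
  rfl

theorem exists_smul (s : S) (x : ArrowBiset a b) :
    ∃ y : ArrowBiset a b, IsProd (a.elt s) x.arr y.arr := by
  obtain ⟨k, hk⟩ := a.exists_isProd (g := a.elt s) ⟨_, (a.dom_elt s).symm⟩ x.cod_mem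
  exact ⟨⟨k, a.mem_range_of_le hk.cod_le ⟨_, (a.cod_elt s).symm⟩,
    b.mem_range_of_le hk.dom_le x.dom_mem⟩, hk⟩

theorem exists_rsmul (x : ArrowBiset a b) (t : T) :
    ∃ y : ArrowBiset a b, IsProd x.arr (b.elt t) y.arr := by
  obtain ⟨k, hk⟩ := b.exists_isProd (h := b.elt t) x.dom_mem ⟨_, (b.cod_elt t).symm⟩
  exact ⟨⟨k, a.mem_range_of_le hk.cod_le x.cod_mem,
    b.mem_range_of_le hk.dom_le ⟨_, (b.dom_elt t).symm⟩⟩, hk⟩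

theorem exists_left (x y : ArrowBiset a b) : ∃ s : S, IsProd x.arr (G.inv y.arr) (a.elt s) := by
  have hy : G.dom (G.inv y.arr) ∈ Set.range a.idem := (G.dom_inv y.arr).symm ▸ y.cod_mem
  obtain ⟨k, hk⟩ := b.exists_isProd (h := G.inv y.arr) x.dom_mem
    ((G.cod_inv y.arr).symm ▸ y.dom_mem)
  obtain ⟨s, rfl⟩ := a.exists_elt (a.mem_range_of_le hk.dom_le hy)
    (a.mem_range_of_le hk.cod_le x.cod_mem)
  exact ⟨s, hk⟩

theorem exists_right (x y : ArrowBiset a b) : ∃ t : T, IsProd (G.inv x.arr) y.arr (b.elt t) := by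
  have hx : G.cod (G.inv x.arr) ∈ Set.range b.idem := (G.cod_inv x.arr).symm ▸ x.dom_mem
  obtain ⟨k, hk⟩ := a.exists_isProd (g := G.inv x.arr) ((G.dom_inv x.arr).symm ▸ x.cod_mem)
    y.cod_mem
  obtain ⟨t, rfl⟩ := b.exists_elt (b.mem_range_of_le hk.dom_le y.dom_mem)
    (b.mem_range_of_le hk.cod_le hx)
  exact ⟨t, hk⟩

variable (a b) in
/-- `S` acts on the left by the pseudoproduct. -/
noncomputable instance : SemigroupAction S (ArrowBiset a b) where
  smul s x := (exists_smul s x).choose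
  mul_smul s t x := ext_arr ((a.isProd_elt s t).assoc (exists_smul (s * t) x).choose_spec
    (exists_smul t x).choose_spec (exists_smul s _).choose_spec)

variable (a b) in
/-- `T` acts on the right by the pseudoproduct. -/
noncomputable instance : SemigroupAction Tᵐᵒᵖ (ArrowBiset a b) where
  smul t x := (exists_rsmul x t.unop).choose
  mul_smul t t' x := ext_arr ((exists_rsmul x t'.unop).choose_spec.assoc
    (exists_rsmul _ t.unop).choose_spec (b.isProd_elt t'.unop t.unop)
    (exists_rsmul x (t'.unop * t.unop)).choose_spec).symm

theorem isProd_smul (s : S) (x : ArrowBiset a b) : IsProd (a.elt s) x.arr (s • x).arr :=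
  (exists_smul s x).choose_spec

theorem isProd_rsmul (x : ArrowBiset a b) (t : T) : IsProd x.arr (b.elt t) (x <• t).arr :=
  (exists_rsmul x t).choose_spec

instance : SMulCommClass S Tᵐᵒᵖ (ArrowBiset a b) where
  smul_comm s t x := ext_arr ((isProd_smul s x).assoc (isProd_rsmul (s • x) t.unop)
    (isProd_rsmul x t.unop) (isProd_smul s (x <• t.unop))).symm

/-- The form `⟨x, y⟩ = xy⁻¹`. -/
noncomputable def left (x y : ArrowBiset a b) : S := (exists_left x y).choose

theorem isProd_left (x y : ArrowBiset a b) : IsProd x.arr (G.inv y.arr) (a.elt (left x y)) :=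
  (exists_left x y).choose_spec

/-- The form `[x, y] = x⁻¹y`. -/
noncomputable def right (x y : ArrowBiset a b) : T := (exists_right x y).choose

theorem isProd_right (x y : ArrowBiset a b) : IsProd (G.inv x.arr) y.arr (b.elt (right x y)) :=
  (exists_right x y).choose_spec

theorem left_smul (s : S) (x y : ArrowBiset a b) : left (s • x) y = s * left x y :=
  a.elt_injective ((isProd_smul s x).assoc (isProd_left (s • x) y) (isProd_left x y)
    (a.isProd_elt s (left x y)))

theorem right_rsmul (x y : ArrowBiset a b) (t : T) : right x (y <• t) = right x y * t :=
  b.elt_injective ((isProd_right x y).assoc (b.isProd_elt (right x y) t) (isProd_rsmul y t)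
    (isProd_right x (y <• t))).symm

theorem elt_left_self (x : ArrowBiset a b) : a.elt (left x x) = G.one (G.cod x.arr) :=
  ((isProd_left x x).unique (isProd_mul _ _ (G.cod_inv x.arr).symm)).trans (G.mul_inv x.arr)

theorem elt_right_self (x : ArrowBiset a b) : b.elt (right x x) = G.one (G.dom x.arr) :=
  ((isProd_right x x).unique (isProd_mul _ _ (G.dom_inv x.arr))).trans (G.inv_mul x.arr)

/-- The arrows of a joint enlargement of `G(S)` and `G(T)` between the idempotents of `T` and
those of `S` form an equivalence biset. -/
noncomputable def equivalenceBiset : EquivalenceBiset S T (ArrowBiset a b) where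
  l := left
  r := right
  l_surjective s := by
    obtain ⟨g, hd, hc⟩ := b.exists_iso (a.idem (domIdem s))
    let x : ArrowBiset a b := ⟨G.inv g, ⟨_, ((G.cod_inv g).trans hd).symm⟩,
      (G.dom_inv g).symm ▸ hc⟩
    refine ⟨s • x, x, ?_⟩
    have h : left x x = star s * s := a.elt_injective (by
      rw [elt_left_self]
      exact (congrArg G.one ((G.cod_inv g).trans hd)).trans (a.elt_idem (domIdem s)).symm)
    rw [left_smul, h, ← mul_assoc, mul_star_mul]
  r_surjective t := by
    obtain ⟨g, hd, hc⟩ := a.exists_iso (b.idem (codIdem t))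
    let x : ArrowBiset a b := ⟨g, hc, ⟨_, hd.symm⟩⟩
    refine ⟨x, x <• t, ?_⟩
    have h : right x x = t * star t := b.elt_injective (by
      rw [elt_right_self]
      exact (congrArg G.one hd).trans (b.elt_idem (codIdem t)).symm)
    rw [right_rsmul, h, mul_star_mul]
  l_smul := left_smul
  l_star x y := a.elt_injective (by
    rw [← a.inv_elt]
    have h := (isProd_left x y).inv
    rw [OrderedGroupoid.inv_inv] at h
    exact (isProd_left y x).unique h)
  l_self_smul x := ext_arr ((isProd_smul _ x).unique (by
    have h := isProd_mul (G.one (G.cod x.arr)) x.arr (G.dom_one _)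
    rwa [G.one_mul, ← elt_left_self] at h))
  r_smul := right_rsmul
  r_star x y := b.elt_injective (by
    rw [← b.inv_elt]
    have h := (isProd_right y x).inv
    rw [OrderedGroupoid.inv_inv] at h
    exact (isProd_right x y).unique h)
  smul_r_self x := ext_arr ((isProd_rsmul x _).unique (by
    have h := isProd_mul x.arr (G.one (G.dom x.arr)) (G.cod_one _).symm
    rwa [G.mul_one, ← elt_right_self] at h))
  l_smul_eq x y z := ext_arr ((isProd_left x y).assoc (isProd_smul _ z) (isProd_right y z)
    (isProd_rsmul x _))

end ArrowBiset

end Arrows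

theorem EnlargementMoritaEquivalent.strong {S T : Type u} [Semigroup S] [IsInverseSemigroup S]
    [Semigroup T] [IsInverseSemigroup T] (h : EnlargementMoritaEquivalent S T) :
    StronglyMoritaEquivalent S T := by
  obtain ⟨G, ⟨a⟩, ⟨b⟩⟩ := h
  exact ⟨ArrowBiset a b, inferInstance, inferInstance, inferInstance,
    ⟨ArrowBiset.equivalenceBiset⟩⟩

/-! ### The equivalence of the notions of Morita equivalence -/

/-- The classifying topos of `S` is the category of presheaves on `L(S)`. -/
noncomputable def etaleEquivalence (S : Type u) [Semigroup S] [IsInverseSemigroup S] :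
    EtaleSet S ≌ ((LCat S)ᵒᵖ ⥤ Type u) :=
  (fibreFunctor S).asEquivalence

theorem toposMoritaEquivalent_iff (S T : Type u) [Semigroup S] [IsInverseSemigroup S]
    [Semigroup T] [IsInverseSemigroup T] :
    ToposMoritaEquivalent S T ↔ Nonempty (LCat S ≌ LCat T) := by
  constructor
  · rintro ⟨E⟩
    exact lCat_equivalence_of_presheaf
      ((etaleEquivalence S).symm.trans (E.trans (etaleEquivalence T)))
  · rintro ⟨E⟩
    exact ⟨(etaleEquivalence S).trans (E.op.congrLeft.trans (etaleEquivalence T).symm)⟩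

theorem tfae_moritaEquivalent (S T : Type u) [Semigroup S] [IsInverseSemigroup S]
    [Semigroup T] [IsInverseSemigroup T] :
    List.TFAE [StronglyMoritaEquivalent S T, ToposMoritaEquivalent S T,
      SemigroupMoritaEquivalent S T, Nonempty (UnitarySet S ≌ UnitarySet T),
      EnlargementMoritaEquivalent S T] := by
  tfae_have 1 → 4 := StronglyMoritaEquivalent.unitary
  tfae_have 3 ↔ 4 := semigroupMoritaEquivalent_iff S T
  tfae_have 4 → 2 := fun ⟨E⟩ =>
    (toposMoritaEquivalent_iff S T).2 (lCat_equivalence_of_unitary E)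
  tfae_have 2 → 5 := fun h =>
    ((toposMoritaEquivalent_iff S T).1 h).elim EnlargementMoritaEquivalent.of_lCat
  tfae_have 5 → 1 := EnlargementMoritaEquivalent.strong
  tfae_finish

end InverseSemigroup

theorem mainTheorem1 (S T : Type u) [Semigroup S] [InverseSemigroup.IsInverseSemigroup S]
    [Semigroup T] [InverseSemigroup.IsInverseSemigroup T] :
    (InverseSemigroup.StronglyMoritaEquivalent S T ↔
      InverseSemigroup.SemigroupMoritaEquivalent S T) ∧
    List.TFAE [
      InverseSemigroup.StronglyMoritaEquivalent S T,
      InverseSemigroup.ToposMoritaEquivalent S T,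
      InverseSemigroup.SemigroupMoritaEquivalent S T,
      Nonempty (CategoryTheory.Equivalence
        (InverseSemigroup.UnitarySet S) (InverseSemigroup.UnitarySet T)),
      InverseSemigroup.EnlargementMoritaEquivalent S T] ∧
    Nonempty (CategoryTheory.Equivalence (InverseSemigroup.EtaleSet S)
      (CategoryTheory.Functor (InverseSemigroup.LCat S)ᵒᵖ (Type u))) ∧
    Nonempty (CategoryTheory.Equivalence (InverseSemigroup.EtaleSet T)
      (CategoryTheory.Functor (InverseSemigroup.LCat T)ᵒᵖ (Type u))) := by
  have h := InverseSemigroup.tfae_moritaEquivalent S T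
  exact ⟨h.out 0 2, h, ⟨InverseSemigroup.etaleEquivalence S⟩, ⟨InverseSemigroup.etaleEquivalence T⟩⟩
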